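/- Let $a:[0,\infty)\to[0,\infty)$ be right-continuous and integrable on every interval $[0,T]$ (for instance continuous, or piecewise constant). For $N\ge 1$ and $x\in\{D,G\}^N$ let $N_G(x)$ be the number of coordinates of $x$ equal to $G$, let $x^{i\to G}$ be $x$ with its $i$-th coordinate replaced by $G$, and let $$(\mathcal L_tF)(x)=\sum_{i=1}^N \mathbf 1_{\{x^i=D\}}\,a(t)\frac{N_G(x)}{N}\,\bigl(F(x^{i\to G})-F(x)\bigr),\qquad F:\{D,G\}^N\to\mathbb R .$$ For each $N\ge1$ let $X^N=(X^N(t))_{t\ge0}$ be a càdlàg continuous-time Markov chain on $\{D,G\}^N$ with respect to a filtration $(\mathcal F^N_t)$ on some probability space, with arbitrary initial law and with generator $\mathcal L_t$. That is, there are stochastic matrices $P_{s,t}$ ($0\le s\le t$), satisfying $P_{s,s}=I$ and the Chapman–Kolmogorov equations and continuous in $t\ge s$, such that $\lim_{h\downarrow0}h^{-1}(P_{t,t+h}F-F)=\mathcal L_tF$ for all $t\ge 0$ and all $F$, and $\mathbb E[F(X^N(t))\mid\mathcal F^N_s]=(P_{s,t}F)(X^N(s))$ almost surely for all $s\le t$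 and all $F$. Put $p_G^N(t)=N_G(X^N(t))/N$. 1. (Dynkin identity.) There are square-integrable mean-zero $(\mathcal F^N_t)$-martingales $M^N$ such that, for all $N\ge1$ and $t\ge 0$, $$p_G^N(t)=p_G^N(0)+\int_0^t a(s)\bigl(1-p_G^N(s)\bigr)p_G^N(s)\,ds+\frac{M^N_t}{N}.$$ Moreover, as $N\to\infty$, $\mathbb E\bigl[(M^N_t/N)^2\bigr]\to0$ for every $t\ge0$, and $\mathbb E\bigl[\sup_{t\le T}(M^N_t/N)^2\bigr]\to0$ for every $T\ge 0$. 2. (Limit model.) If $p_G^N(0)$ converges in probability to a number $p_G^0\in[0,1]$, then the equation $$p_G(t)=p_G^0+\int_0^t a(s)\bigl(1-p_G(s)\bigr)p_G(s)\,ds,\qquad t\ge0,$$ has a unique continuous solution $p_G:[0,\infty)\to\mathbb R$. It satisfies $p_G(0)=p_G^0$. Its right derivative at every $t\ge0$ is $a(t)(1-p_G(t))p_G(t)$, and it is differentiable with this derivative at every $t>0$ at which $a$ is continuous. Finally, $p_G^N\to p_G$ in probability, uniformly on compact time intervals: for all $T\ge0$ and $\varepsilon>0$, $$\mathbb P\Bigl(\exists\,t\le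 T:\ \bigl|p_G^N(t)-p_G(t)\bigr|\ge\varepsilon\Bigr)\to0\quad\text{as }N\to\infty .$$ -/

import Mathlib

open Set Filter Topology MeasureTheory ProbabilityTheory
open scoped NNReal ENNReal Matrix

namespace GreenTransition

/-- The state of an agent: Deliberating (`D`) or Green (`G`). -/
inductive Status : Type
  | D : Status
  | G : Status
  deriving DecidableEq

instance : Fintype Status :=
  ⟨{Status.D, Status.G}, fun x => by cases x <;> simp⟩

instance : TopologicalSpace Status := ⊥

instance : DiscreteTopology Status := ⟨rfl⟩

instance : MeasurableSpace Status := ⊤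

/-- The state space `{D, G}^N` of the population. -/
abbrev Config (N : ℕ) : Type := Fin N → Status

/-- `N_G(x)`, the number of Green agents in the configuration `x`. -/
def greenCount {N : ℕ} (x : Config N) : ℕ :=
  (Finset.univ.filter fun i => x i = Status.G).card

/-- `N_G(x) / N`, the fraction of Green agents in the configuration `x`. -/
noncomputable def greenFraction {N : ℕ} (x : Config N) : ℝ :=
  (greenCount x : ℝ) / (N : ℝ)

/-- `λ_N(x, t) = a(t) N_G(x) / N`, the rate at which each Deliberating agent turns Green. -/
noncomputable def rate (a : ℝ → ℝ) {N : ℕ} (t : ℝ) (x : Config N) : ℝ :=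
  a t * ((greenCount x : ℝ) / (N : ℝ))

/-- The infinitesimal generator
`(L_t F)(x) = ∑_i 1_{x_i = D} λ_N(x, t) (F(x^{i → G}) - F(x))`. -/
noncomputable def generator (a : ℝ → ℝ) {N : ℕ} (t : ℝ) (F : Config N → ℝ) (x : Config N) : ℝ :=
  ∑ i : Fin N, if x i = Status.D
    then rate a t x * (F (Function.update x i Status.G) - F x) else 0

/-- `P s t x y` (for `s ≤ t`) is the transition function of a continuous-time Markov chain on
`{D, G}^N` whose infinitesimal generator at time `t` is `generator a t`. -/
structure IsTransitionFunction (a : ℝ → ℝ) (N : ℕ)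
    (P : ℝ≥0 → ℝ≥0 → Matrix (Config N) (Config N) ℝ) : Prop where
  /-- Each `P s t` is a stochastic matrix. -/
  stochastic : ∀ s t, s ≤ t → P s t ∈ Matrix.rowStochastic ℝ (Config N)
  refl : ∀ s, P s s = 1
  /-- Chapman-Kolmogorov. -/
  comp : ∀ s t u, s ≤ t → t ≤ u → P s u = P s t * P t u
  /-- Continuity in the final time: there are no jumps at deterministic times. -/
  continuousOn : ∀ s, ContinuousOn (fun t => P s t) (Ici s)
  /-- The infinitesimal transition mechanism at each time `t`. -/
  hasGenerator : ∀ (t : ℝ≥0) (F : Config N → ℝ) (x : Config N),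
    Tendsto (fun h : ℝ≥0 => ((P t (t + h) *ᵥ F) x - F x) / (h : ℝ)) (𝓝[>] 0)
      (𝓝 (generator a (t : ℝ) F x))

/-- `X` is a càdlàg `{D, G}^N`-valued process on `(Ω, μ)` that is a continuous-time Markov chain
with respect to the filtration `ℱ`, with infinitesimal generator `generator a t` at time `t`.
The initial law is arbitrary. -/
structure IsMarkovChain (a : ℝ → ℝ) (N : ℕ) {Ω : Type*} [m : MeasurableSpace Ω] (μ : Measure Ω)
    (ℱ : Filtration ℝ≥0 m) (X : ℝ≥0 → Ω → Config N) : Prop where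
  adapted : ∀ t, Measurable[ℱ t] (X t)
  rightCont : ∀ ω t, ContinuousWithinAt (fun s => X s ω) (Ici t) t
  leftLim : ∀ ω t, ∃ x, Tendsto (fun s => X s ω) (𝓝[<] t) (𝓝 x)
  markov : ∃ P : ℝ≥0 → ℝ≥0 → Matrix (Config N) (Config N) ℝ,
    IsTransitionFunction a N P ∧
    ∀ s t, s ≤ t → ∀ F : Config N → ℝ,
      μ[fun ω => F (X t ω) | ℱ s] =ᵐ[μ] fun ω => (P s t *ᵥ F) (X s ω)

/-- `p` is a continuous function on `[0, ∞)` with `p(t) = p₀ + ∫_0^t a(s) (1 - p(s)) p(s) ds`. -/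
structure IsLogisticSolution (a : ℝ → ℝ) (p₀ : ℝ) (p : ℝ → ℝ) : Prop where
  continuousOn : ContinuousOn p (Ici 0)
  integral_eq : ∀ t, 0 ≤ t → p t = p₀ + ∫ s in (0 : ℝ)..t, a s * (1 - p s) * p s

end GreenTransition

/-!
The fraction `p` of Green agents jumps by `1 / N`, and at time `t` it does so at total rate
`N a(t) (1 - p) p`. The generator therefore maps `p` to `a (1 - p) p` and `p²` to
`a (1 - p) p (2 p + 1 / N)` (`generator_comp_greenFraction`).

*Dynkin's formula.* By Chapman-Kolmogorov, `u ↦ P_{s,u} F` is continuous with right derivative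
`P_{s,u} L_u F`, which is right-continuous and locally integrable; the fundamental theorem of
calculus for right derivatives gives the integrated forward equation
(`IsTransitionFunction.forward_equation`). Together with the Markov property and Fubini's theorem it
makes `F(X_t) - F(X_0) - ∫_0^t L_s F(X_s) ds` a martingale (`IsMarkovChain.martingale_dynkin`).
Measurability of the time integral comes from right-continuity of the paths, which makes them
jointly measurable in time and chance.

*Second moment.* Comparing the martingales of `p` and `p²` shows that the martingale part `m` of `p`
satisfies `E[m_t²] = E[∫_0^t a (1 - p) p] / N` (`integral_sq_martingale`), which is at most
`(∫_0^t a) / N`. Since `|m|` is bounded by `1 + ∫_0^T a` on `[0, T]` uniformly in `N`, the weak-type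
maximal inequality, extended to continuous time along finer and finer grids, also forces
`E[sup_{t ≤ T} m_t²] → 0` (`lintegral_iSup_sq_le`).

*The limit.* The logistic equation has the explicit solution `p₀ e^B / (1 - p₀ + p₀ e^B)` with
`B(t) = ∫_0^t a`. As `(1 - p) p - (1 - q) q = (1 - q - p) (p - q)`, Grönwall's inequality with the
integrable kernel `a` (`RightContLocInt.gronwall`) yields both its uniqueness and the pathwise bound
`|p^N - p| ≤ (|p^N(0) - p₀| + sup |m|) e^B`, from which the convergence in probability follows.
-/

namespace GreenTransition

/-! ### Right-continuous processes are jointly measurable -/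

/-- The first point `k / (n + 1)` of the `n`-th grid strictly after `s`, truncated at `t`, converges
to `min s t` from the right. -/
theorem tendsto_grid (s t : ℝ≥0) :
    Tendsto (fun n : ℕ => min (((⌊((n : ℝ≥0) + 1) * s⌋₊ : ℝ≥0) + 1) / ((n : ℝ≥0) + 1)) t) atTop
      (𝓝[≥] (min s t)) := by
  have hlow : ∀ n : ℕ, s ≤ ((⌊((n : ℝ≥0) + 1) * s⌋₊ : ℝ≥0) + 1) / ((n : ℝ≥0) + 1) := fun n => by
    rw [le_div_iff₀ (by positivity), mul_comm]
    exact (Nat.lt_floor_add_one _).le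
  have hup : ∀ n : ℕ, ((⌊((n : ℝ≥0) + 1) * s⌋₊ : ℝ≥0) + 1) / ((n : ℝ≥0) + 1)
      ≤ s + 1 / ((n : ℝ≥0) + 1) := fun n => by
    rw [add_div]
    gcongr
    rw [div_le_iff₀ (by positivity), mul_comm]
    exact Nat.floor_le (by positivity)
  have hlim : Tendsto (fun n : ℕ => s + 1 / ((n : ℝ≥0) + 1)) atTop (𝓝 s) := by
    simpa using
      (tendsto_const_nhds (x := s)).add (tendsto_one_div_add_atTop_nhds_zero_nat (𝕜 := ℝ≥0))
  have h := tendsto_of_tendsto_of_tendsto_of_le_of_le tendsto_const_nhds hlim hlow hup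
  exact tendsto_nhdsWithin_iff.2
    ⟨h.min tendsto_const_nhds, Eventually.of_forall fun n => min_le_min_right _ (hlow n)⟩

/-- A right-continuous process whose values up to time `t` are measurable is, when stopped at `t`,
jointly measurable. It is the pointwise limit of its discretizations at the first grid point
strictly after the current time. -/
theorem measurable_uncurry_min_of_rightCont {Ω : Type*} {mΩ : MeasurableSpace Ω}
    {Y : ℝ≥0 → Ω → ℝ} (t : ℝ≥0) (hm : ∀ s ≤ t, Measurable (Y s))
    (hc : ∀ ω s, ContinuousWithinAt (fun u => Y u ω) (Ici s) s) :
    Measurable fun p : ℝ≥0 × Ω => Y (min p.1 t) p.2 := by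
  let d : ℕ → ℕ → ℝ≥0 := fun n k => min (((k : ℝ≥0) + 1) / ((n : ℝ≥0) + 1)) t
  refine measurable_of_tendsto_metrizable
    (f := fun n (p : ℝ≥0 × Ω) => Y (d n ⌊((n : ℝ≥0) + 1) * p.1⌋₊) p.2) (fun n => ?_) ?_
  · have h1 : Measurable fun q : ℕ × Ω => Y (d n q.1) q.2 :=
      measurable_from_prod_countable_right fun k => hm (d n k) (min_le_right _ _)
    have h2 : Measurable fun p : ℝ≥0 × Ω => (⌊((n : ℝ≥0) + 1) * p.1⌋₊, p.2) :=
      (Nat.measurable_floor.comp (measurable_fst.const_mul _)).prodMk measurable_snd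
    have h3 := h1.comp h2
    simpa only [Function.comp_def] using h3
  · rw [tendsto_pi_nhds]
    rintro ⟨s, ω⟩
    exact (hc ω (min s t)).tendsto.comp (tendsto_grid s t)

/-! ### Calculus for right-continuous, locally integrable functions -/

/-- The function `z` is right-continuous on `[0, ∞)` and integrable on every `[0, T]`; nothing is
required on `(-∞, 0)`. -/
structure RightContLocInt (z : ℝ → ℝ) : Prop where
  rightCont : ∀ t, 0 ≤ t → ContinuousWithinAt z (Ici t) t
  int : ∀ T, 0 ≤ T → IntervalIntegrable z volume 0 T

/-- A right-continuous function on `[0, ∞)` is measurable there. -/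
theorem aestronglyMeasurable_of_rightCont {y : ℝ → ℝ}
    (hy : ∀ t, 0 ≤ t → ContinuousWithinAt y (Ici t) t) (T : ℝ) :
    AEStronglyMeasurable y (volume.restrict (Ioc 0 T)) := by
  have h := measurable_uncurry_min_of_rightCont (Ω := Unit) (mΩ := ⊤) (Y := fun s _ => y s) T.toNNReal
    (fun s _ => measurable_const) (fun _ s => by
      refine (hy s s.2).comp NNReal.continuous_coe.continuousWithinAt fun u hu => ?_
      exact_mod_cast hu)
  have h2 : Measurable fun s : ℝ => y ((min s.toNNReal T.toNNReal : ℝ≥0) : ℝ) :=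
    h.comp (measurable_real_toNNReal.prodMk (measurable_const (a := ())))
  refine (h2.aestronglyMeasurable (μ := volume.restrict (Ioc 0 T))).congr ?_
  filter_upwards [ae_restrict_mem measurableSet_Ioc] with s hs
  rw [min_eq_left (Real.toNNReal_le_toNNReal hs.2), Real.coe_toNNReal _ hs.1.le]

namespace RightContLocInt

variable {z y : ℝ → ℝ}

theorem intervalIntegrable (hz : RightContLocInt z) {s t : ℝ} (hs : 0 ≤ s) (ht : 0 ≤ t) :
    IntervalIntegrable z volume s t :=
  (hz.int s hs).symm.trans (hz.int t ht)

theorem mul (hz : RightContLocInt z) (hy : ∀ t, 0 ≤ t → ContinuousWithinAt y (Ici t) t)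
    (hb : ∀ T, 0 ≤ T → ∃ C, ∀ t ∈ Ioc 0 T, |y t| ≤ C) : RightContLocInt fun t => z t * y t where
  rightCont t ht := (hz.rightCont t ht).mul (hy t ht)
  int T hT := by
    obtain ⟨C, hC⟩ := hb T hT
    rw [intervalIntegrable_iff_integrableOn_Ioc_of_le hT]
    refine Integrable.mul_bdd (c := C)
      ((intervalIntegrable_iff_integrableOn_Ioc_of_le hT).1 (hz.int T hT))
      (aestronglyMeasurable_of_rightCont hy T) ?_
    filter_upwards [ae_restrict_mem measurableSet_Ioc] with s hs using hC s hs

theorem mul_continuousOn (hz : RightContLocInt z) (hy : ContinuousOn y (Ici 0)) :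
    RightContLocInt fun t => z t * y t := by
  refine hz.mul (fun t ht => (hy t ht).mono (Ici_subset_Ici.2 ht)) fun T _ => ?_
  obtain ⟨C, hC⟩ := isCompact_Icc.exists_bound_of_continuousOn
    (hy.mono (Icc_subset_Ici_self : Icc 0 T ⊆ Ici 0))
  exact ⟨C, fun t ht => hC t (Ioc_subset_Icc_self ht)⟩

theorem continuousOn_primitive (hz : RightContLocInt z) :
    ContinuousOn (fun t => ∫ s in (0 : ℝ)..t, z s) (Ici 0) := by
  intro t ht
  have ht' : (0 : ℝ) ≤ t := ht
  have h := intervalIntegral.continuousOn_primitive_interval' (hz.int (t + 1) (by linarith))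
    left_mem_uIcc
  rw [uIcc_of_le (by linarith)] at h
  refine (h t ⟨ht, by linarith⟩).mono_of_mem_nhdsWithin ?_
  rw [← Ici_inter_Iic]
  exact inter_mem_nhdsWithin _ (Iic_mem_nhds (by linarith))

theorem hasDerivWithinAt_primitive (hz : RightContLocInt z) {t : ℝ} (ht : 0 ≤ t) :
    HasDerivWithinAt (fun u => ∫ s in (0 : ℝ)..u, z s) (z t) (Ici t) t := by
  refine intervalIntegral.integral_hasDerivWithinAt_right (t := Ioi t) (hz.int t ht) ?_
    ((hz.rightCont t ht).mono Ioi_subset_Ici_self)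
  refine ⟨Ioc t (t + 1), Ioc_mem_nhdsGT (by linarith), ?_⟩
  have := (hz.intervalIntegrable ht (show 0 ≤ t + 1 by linarith))
  exact ((intervalIntegrable_iff_integrableOn_Ioc_of_le (by linarith)).1 this).aestronglyMeasurable

/-- The fundamental theorem of calculus for right derivatives. -/
theorem integral_eq_sub (hz : RightContLocInt z) {f : ℝ → ℝ} {s t : ℝ} (hs : 0 ≤ s) (hst : s ≤ t)
    (hf : ContinuousOn f (Ici s))
    (hd : ∀ u, s ≤ u → HasDerivWithinAt f (z u) (Ici u) u) :
    ∫ u in s..t, z u = f t - f s :=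
  intervalIntegral.integral_eq_sub_of_hasDeriv_right_of_le hst (hf.mono Icc_subset_Ici_self)
    (fun u hu => (hd u hu.1.le).mono Ioi_subset_Ici_self)
    (hz.intervalIntegrable hs (hs.trans hst))

theorem sq_primitive (hz : RightContLocInt z) {t : ℝ} (ht : 0 ≤ t) :
    (∫ s in (0 : ℝ)..t, z s) ^ 2 = ∫ s in (0 : ℝ)..t, 2 * (z s * ∫ u in (0 : ℝ)..s, z u) := by
  have h := hz.mul_continuousOn (hz.continuousOn_primitive.const_smul (2 : ℝ))
  have h2 := h.integral_eq_sub (f := fun t => (∫ s in (0 : ℝ)..t, z s) ^ 2) le_rfl ht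
    (hz.continuousOn_primitive.pow 2) (fun u hu => by
      refine ((hz.hasDerivWithinAt_primitive hu).pow 2).congr_deriv ?_
      simp; ring)
  simp only [intervalIntegral.integral_same, ne_eq, OfNat.ofNat_ne_zero, not_false_eq_true,
    zero_pow, sub_zero] at h2
  rw [← h2]
  congr 1
  ext s
  simp only [Pi.smul_apply, smul_eq_mul]
  ring

/-- **Grönwall's inequality** with an integrable, right-continuous kernel. -/
theorem gronwall (hz : RightContLocInt z) (hz0 : ∀ t, 0 ≤ t → 0 ≤ z t)
    (hy : ∀ t, 0 ≤ t → ContinuousWithinAt y (Ici t) t)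
    (hb : ∀ T, 0 ≤ T → ∃ C, ∀ t ∈ Ioc 0 T, |y t| ≤ C) {δ T : ℝ}
    (h : ∀ t ∈ Icc 0 T, y t ≤ δ + ∫ s in (0 : ℝ)..t, z s * y s) {t : ℝ} (ht : t ∈ Icc 0 T) :
    y t ≤ δ * Real.exp (∫ s in (0 : ℝ)..t, z s) := by
  have hzy := hz.mul hy hb
  set B : ℝ → ℝ := fun t => ∫ s in (0 : ℝ)..t, z s with hB
  set Φ : ℝ → ℝ := fun t => δ + ∫ s in (0 : ℝ)..t, z s * y s with hΦ
  have hderiv : ∀ u, 0 ≤ u → HasDerivWithinAt (fun u => Φ u * Real.exp (-B u))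
      (z u * y u * Real.exp (-B u) + Φ u * (Real.exp (-B u) * -z u)) (Ici u) u := fun u hu =>
    ((hzy.hasDerivWithinAt_primitive hu).const_add δ).mul
      ((hz.hasDerivWithinAt_primitive hu).neg.exp)
  have hmono : Φ t * Real.exp (-B t) - Φ 0 * Real.exp (-B 0) ≤ ∫ _ in (0 : ℝ)..t, (0 : ℝ) := by
    refine intervalIntegral.sub_le_integral_of_hasDeriv_right_of_le ht.1
      (g := fun u => Φ u * Real.exp (-B u)) ?_
      (fun u hu => (hderiv u hu.1.le).mono Ioi_subset_Ici_self) (integrableOn_const (by simp)) ?_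
    · exact ContinuousOn.mono ((continuousOn_const.add hzy.continuousOn_primitive).mul
        hz.continuousOn_primitive.neg.rexp) Icc_subset_Ici_self
    · intro u hu
      have h1 := h u ⟨hu.1.le, hu.2.le.trans ht.2⟩
      have h2 : 0 ≤ z u * Real.exp (-B u) * (Φ u - y u) :=
        mul_nonneg (mul_nonneg (hz0 u hu.1.le) (Real.exp_pos _).le) (sub_nonneg.2 h1)
      linarith
  simp only [hΦ, hB, intervalIntegral.integral_same, add_zero, neg_zero, Real.exp_zero, mul_one,
    intervalIntegral.integral_zero, sub_nonpos] at hmono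
  rw [Real.exp_neg, ← div_eq_mul_inv, div_le_iff₀ (Real.exp_pos _)] at hmono
  exact (h t ht).trans hmono

end RightContLocInt

/-! ### The logistic equation -/

section Logistic

variable {a : ℝ → ℝ} {p₀ : ℝ}

/-- The solution `p₀ e^B / (1 - p₀ + p₀ e^B)`, with `B(t) = ∫_0^t a`, of the logistic equation
`p' = a (1 - p) p` started at `p₀`. -/
noncomputable def logistic (a : ℝ → ℝ) (p₀ : ℝ) (t : ℝ) : ℝ :=
  p₀ * Real.exp (∫ s in (0 : ℝ)..t, a s) / (1 - p₀ + p₀ * Real.exp (∫ s in (0 : ℝ)..t, a s))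

theorem logistic_denom_pos (hp : p₀ ∈ Icc (0 : ℝ) 1) (x : ℝ) :
    0 < 1 - p₀ + p₀ * Real.exp x := by
  have := Real.exp_pos x
  rcases hp.1.eq_or_lt with h | h
  · simp [← h]
  · have := mul_pos h this
    linarith [hp.2]

theorem logistic_mem_Icc (hp : p₀ ∈ Icc (0 : ℝ) 1) (t : ℝ) : logistic a p₀ t ∈ Icc (0 : ℝ) 1 := by
  have h := logistic_denom_pos hp (∫ s in (0 : ℝ)..t, a s)
  refine ⟨div_nonneg (mul_nonneg hp.1 (Real.exp_pos _).le) h.le, ?_⟩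
  rw [logistic, div_le_one h]
  linarith [hp.2]

theorem logistic_zero : logistic a p₀ 0 = p₀ := by simp [logistic]

theorem continuousOn_logistic (ha : RightContLocInt a) (hp : p₀ ∈ Icc (0 : ℝ) 1) :
    ContinuousOn (logistic a p₀) (Ici 0) := by
  have h := ha.continuousOn_primitive.rexp.const_smul p₀
  exact h.div (continuousOn_const.add h) fun t _ => (logistic_denom_pos hp _).ne'

theorem hasDerivWithinAt_logistic (hp : p₀ ∈ Icc (0 : ℝ) 1) {t : ℝ} {S : Set ℝ}
    (h : HasDerivWithinAt (fun u => ∫ s in (0 : ℝ)..u, a s) (a t) S t) :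
    HasDerivWithinAt (logistic a p₀) (a t * (1 - logistic a p₀ t) * logistic a p₀ t) S t := by
  have hpos := logistic_denom_pos hp (∫ s in (0 : ℝ)..t, a s)
  refine ((h.exp.const_mul p₀).div ((h.exp.const_mul p₀).const_add (1 - p₀)) hpos.ne').congr_deriv ?_
  rw [logistic]
  field_simp

theorem isLogisticSolution_logistic (ha : RightContLocInt a) (hp : p₀ ∈ Icc (0 : ℝ) 1) :
    IsLogisticSolution a p₀ (logistic a p₀) where
  continuousOn := continuousOn_logistic ha hp
  integral_eq t ht := by
    have hc := continuousOn_logistic ha hp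
    have h := (ha.mul_continuousOn (continuousOn_const (c := (1 : ℝ)) |>.sub hc)).mul_continuousOn hc
    have h2 := h.integral_eq_sub le_rfl ht hc fun u hu =>
      hasDerivWithinAt_logistic hp (ha.hasDerivWithinAt_primitive hu)
    rw [logistic_zero] at h2
    change _ = p₀ + ∫ s in (0 : ℝ)..t, a s * (1 - logistic a p₀ s) * logistic a p₀ s
    simp only [Pi.sub_apply] at h2
    linarith

/-- Stability of the logistic equation: if `p` and `q` satisfy it up to errors whose difference is
at most `δ`, and `|1 - q - p| ≤ K`, then `p` and `q` differ by at most `δ e^{K ∫ a}`. -/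
theorem abs_sub_le_of_logistic (ha : RightContLocInt a) (ha0 : ∀ t, 0 ≤ t → 0 ≤ a t)
    {p q e e' : ℝ → ℝ} (hp : ∀ t, 0 ≤ t → ContinuousWithinAt p (Ici t) t)
    (hq : ∀ t, 0 ≤ t → ContinuousWithinAt q (Ici t) t)
    (hpb : ∀ T, 0 ≤ T → ∃ C, ∀ t ∈ Ioc 0 T, |p t| ≤ C)
    (hqb : ∀ T, 0 ≤ T → ∃ C, ∀ t ∈ Ioc 0 T, |q t| ≤ C) {δ K T : ℝ} (hK : 0 ≤ K)
    (hpe : ∀ t ∈ Icc 0 T, p t = e t + ∫ s in (0 : ℝ)..t, a s * (1 - p s) * p s)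
    (hqe : ∀ t ∈ Icc 0 T, q t = e' t + ∫ s in (0 : ℝ)..t, a s * (1 - q s) * q s)
    (hδ : ∀ t ∈ Icc 0 T, |e t - e' t| ≤ δ) (hpq : ∀ t ∈ Ioc 0 T, |1 - q t - p t| ≤ K)
    {t : ℝ} (ht : t ∈ Icc 0 T) :
    |p t - q t| ≤ δ * Real.exp (∫ s in (0 : ℝ)..t, a s * K) := by
  have hgen : ∀ r : ℝ → ℝ, (∀ t, 0 ≤ t → ContinuousWithinAt r (Ici t) t) →
      (∀ T, 0 ≤ T → ∃ C, ∀ t ∈ Ioc 0 T, |r t| ≤ C) →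
      RightContLocInt fun s => a s * (1 - r s) * r s := fun r hr hrb => by
    refine (ha.mul (y := fun s => 1 - r s) (fun t ht => continuousWithinAt_const.sub (hr t ht))
      fun T hT => ?_).mul hr hrb
    obtain ⟨C, hC⟩ := hrb T hT
    exact ⟨1 + C, fun t ht => (abs_sub _ _).trans (by simpa using hC t ht)⟩
  have haK : RightContLocInt fun s => a s * K := ha.mul_continuousOn continuousOn_const
  have hdc : ∀ t, 0 ≤ t → ContinuousWithinAt (fun t => |p t - q t|) (Ici t) t :=
    fun t ht => ((hp t ht).sub (hq t ht)).abs
  have hdb : ∀ T, 0 ≤ T → ∃ C, ∀ t ∈ Ioc 0 T, |(|p t - q t|)| ≤ C := fun T hT => by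
    obtain ⟨C, hC⟩ := hpb T hT
    obtain ⟨C', hC'⟩ := hqb T hT
    exact ⟨C + C', fun t ht => by
      rw [abs_abs]; exact (abs_sub _ _).trans (add_le_add (hC t ht) (hC' t ht))⟩
  refine haK.gronwall (fun t ht => mul_nonneg (ha0 t ht) hK) hdc hdb (fun t ht => ?_) ht
  have hint := (haK.mul hdc hdb).int t ht.1
  rw [hpe t ht, hqe t ht, add_sub_add_comm, ← intervalIntegral.integral_sub
    ((hgen p hp hpb).int t ht.1) ((hgen q hq hqb).int t ht.1)]
  refine (abs_add_le _ _).trans (add_le_add (hδ t ht) ?_)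
  rw [← Real.norm_eq_abs]
  refine intervalIntegral.norm_integral_le_of_norm_le ht.1 ?_ hint
  refine Eventually.of_forall fun s hs => ?_
  -- the logistic nonlinearity factors as `(1 - p) p - (1 - q) q = (1 - q - p) (p - q)`
  have h1 : a s * (1 - p s) * p s - a s * (1 - q s) * q s = a s * ((1 - q s - p s) * (p s - q s)) := by
    ring
  rw [h1, Real.norm_eq_abs, abs_mul, abs_mul, abs_of_nonneg (ha0 s hs.1.le), mul_assoc]
  gcongr
  · exact ha0 s hs.1.le
  · exact hpq s ⟨hs.1, hs.2.trans ht.2⟩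

theorem IsLogisticSolution.eqOn (ha : RightContLocInt a) (ha0 : ∀ t, 0 ≤ t → 0 ≤ a t)
    {p q : ℝ → ℝ} (hp : IsLogisticSolution a p₀ p) (hq : IsLogisticSolution a p₀ q) :
    EqOn p q (Ici 0) := by
  intro t ht
  have hrc : ∀ r : ℝ → ℝ, ContinuousOn r (Ici 0) → ∀ t, 0 ≤ t → ContinuousWithinAt r (Ici t) t :=
    fun r hr t ht => (hr t ht).mono (Ici_subset_Ici.2 ht)
  have hbd : ∀ r : ℝ → ℝ, ContinuousOn r (Ici 0) → ∀ T, 0 ≤ T → ∃ C, ∀ t ∈ Ioc 0 T, |r t| ≤ C :=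
    fun r hr T _ => by
      obtain ⟨C, hC⟩ := isCompact_Icc.exists_bound_of_continuousOn
        (hr.mono (Icc_subset_Ici_self : Icc 0 T ⊆ Ici 0))
      exact ⟨C, fun t ht => hC t (Ioc_subset_Icc_self ht)⟩
  obtain ⟨K, hK⟩ := hbd (fun t => 1 - q t - p t)
    ((continuousOn_const.sub hq.continuousOn).sub hp.continuousOn) t ht
  have h := abs_sub_le_of_logistic ha ha0 (hrc p hp.continuousOn) (hrc q hq.continuousOn)
    (hbd p hp.continuousOn) (hbd q hq.continuousOn) (abs_nonneg K) (e := fun _ => p₀)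
    (e' := fun _ => p₀) (δ := 0)
    (fun s hs => hp.integral_eq s hs.1) (fun s hs => hq.integral_eq s hs.1) (by simp)
    (fun s hs => (hK s hs).trans (le_abs_self K)) (right_mem_Icc.2 ht)
  simpa [sub_eq_zero] using h

end Logistic

/-! ### Time integrals of right-continuous processes -/

theorem measurable_uncurry_min_toNNReal_of_rightCont {Ω : Type*} {mΩ : MeasurableSpace Ω}
    {Y : ℝ≥0 → Ω → ℝ} (t : ℝ≥0) (hm : ∀ s ≤ t, Measurable (Y s))
    (hc : ∀ ω s, ContinuousWithinAt (fun u => Y u ω) (Ici s) s) :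
    Measurable fun p : ℝ × Ω => Y (min p.1.toNNReal t) p.2 := by
  have h := (measurable_uncurry_min_of_rightCont t hm hc).comp
    ((measurable_real_toNNReal.comp measurable_fst).prodMk measurable_snd)
  simpa only [Function.comp_def] using h

/-- The process `∫_0^t Z_s ds`. -/
noncomputable def timeIntegral {Ω : Type*} (Z : ℝ≥0 → Ω → ℝ) (t : ℝ≥0) (ω : Ω) : ℝ :=
  ∫ s in (0 : ℝ)..t, Z s.toNNReal ω

theorem timeIntegral_eq_min {Ω : Type*} {Z : ℝ≥0 → Ω → ℝ} (t : ℝ≥0) :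
    timeIntegral Z t = fun ω => ∫ s in Ioc (0 : ℝ) t, Z (min s.toNNReal t) ω := by
  ext ω
  rw [timeIntegral, intervalIntegral.integral_of_le t.coe_nonneg]
  refine setIntegral_congr_fun measurableSet_Ioc fun s hs => ?_
  have h : s.toNNReal ≤ t := Real.toNNReal_le_iff_le_coe.2 hs.2
  simp only [min_eq_left h]

/-- Passage from time set `ℝ≥0` to `ℝ`, on which the Lebesgue integrals are taken. -/
theorem continuousWithinAt_comp_toNNReal {y : ℝ≥0 → ℝ} {t : ℝ}
    (hy : ContinuousWithinAt y (Ici t.toNNReal) t.toNNReal) :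
    ContinuousWithinAt (fun s : ℝ => y s.toNNReal) (Ici t) t :=
  ContinuousWithinAt.comp (f := Real.toNNReal) (t := Ici t.toNNReal) hy
    continuous_real_toNNReal.continuousWithinAt fun _ hu => Real.toNNReal_le_toNNReal hu

section TimeIntegral

variable {Ω : Type*} [m : MeasurableSpace Ω] {μ : Measure Ω} {ℱ : Filtration ℝ≥0 m} {b : ℝ → ℝ}
  {Z : ℝ≥0 → Ω → ℝ}

/-- `Z` is adapted with right-continuous paths, and `|Z t| ≤ b t` for a deterministic
right-continuous, locally integrable `b`. -/
structure IsDominatedProcess (ℱ : Filtration ℝ≥0 m) (b : ℝ → ℝ) (Z : ℝ≥0 → Ω → ℝ) : Prop where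
  adapted : ∀ t, Measurable[ℱ t] (Z t)
  rightCont : ∀ ω t, ContinuousWithinAt (fun s => Z s ω) (Ici t) t
  bound : ∀ t ω, |Z t ω| ≤ b t
  dom : RightContLocInt b

namespace IsDominatedProcess

theorem measurable (hZ : IsDominatedProcess ℱ b Z) (t : ℝ≥0) : Measurable (Z t) :=
  (hZ.adapted t).mono (ℱ.le t) le_rfl

theorem path (hZ : IsDominatedProcess ℱ b Z) (ω : Ω) :
    RightContLocInt fun s => Z s.toNNReal ω where
  rightCont t _ := continuousWithinAt_comp_toNNReal (hZ.rightCont ω t.toNNReal)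
  int T hT := by
    rw [intervalIntegrable_iff_integrableOn_Ioc_of_le hT]
    refine Integrable.mono' ((intervalIntegrable_iff_integrableOn_Ioc_of_le hT).1 (hZ.dom.int T hT))
      (aestronglyMeasurable_of_rightCont
        (fun t _ => continuousWithinAt_comp_toNNReal (hZ.rightCont ω t.toNNReal)) T) ?_
    filter_upwards [ae_restrict_mem measurableSet_Ioc] with s hs
    have := hZ.bound s.toNNReal ω
    rwa [Real.coe_toNNReal _ hs.1.le] at this

theorem timeIntegral_adapted (hZ : IsDominatedProcess ℱ b Z) (t : ℝ≥0) :
    Measurable[ℱ t] (timeIntegral Z t) := by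
  have h := measurable_uncurry_min_toNNReal_of_rightCont (mΩ := ℱ t) t
    (fun s hs => (hZ.adapted s).mono (ℱ.mono hs) le_rfl) hZ.rightCont
  rw [timeIntegral_eq_min]
  exact (@StronglyMeasurable.integral_prod_left' ℝ Ω ℝ _ (ℱ t) (volume.restrict (Ioc 0 (t : ℝ)))
    _ _ _ _ h.stronglyMeasurable).measurable

theorem abs_timeIntegral_le (hZ : IsDominatedProcess ℱ b Z) (t : ℝ≥0) (ω : Ω) :
    |timeIntegral Z t ω| ≤ ∫ s in (0 : ℝ)..t, b s := by
  rw [← Real.norm_eq_abs]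
  refine intervalIntegral.norm_integral_le_of_norm_le t.coe_nonneg ?_ (hZ.dom.int t t.coe_nonneg)
  refine Eventually.of_forall fun s hs => ?_
  have := hZ.bound s.toNNReal ω
  rwa [Real.coe_toNNReal _ hs.1.le] at this

theorem rightCont_timeIntegral (hZ : IsDominatedProcess ℱ b Z) (ω : Ω) (t : ℝ≥0) :
    ContinuousWithinAt (fun s => timeIntegral Z s ω) (Ici t) t := by
  have h := (hZ.path ω).continuousOn_primitive t t.coe_nonneg
  exact ContinuousWithinAt.comp (f := ((↑) : ℝ≥0 → ℝ)) h NNReal.continuous_coe.continuousWithinAt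
    fun u _ => u.coe_nonneg

theorem timeIntegral_sub (hZ : IsDominatedProcess ℱ b Z) (s t : ℝ≥0) (ω : Ω) :
    timeIntegral Z t ω - timeIntegral Z s ω = ∫ u in (s : ℝ)..t, Z u.toNNReal ω :=
  intervalIntegral.integral_interval_sub_left ((hZ.path ω).int t t.coe_nonneg) ((hZ.path ω).int s s.coe_nonneg)

theorem integrable_timeIntegral [IsFiniteMeasure μ] (hZ : IsDominatedProcess ℱ b Z) (t : ℝ≥0) :
    Integrable (timeIntegral Z t) μ :=
  Integrable.of_bound ((hZ.timeIntegral_adapted t).mono (ℱ.le t) le_rfl).aestronglyMeasurable _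
    (Eventually.of_forall (hZ.abs_timeIntegral_le t))

theorem mul (hZ : IsDominatedProcess ℱ b Z) {W : ℝ≥0 → Ω → ℝ} {w : ℝ → ℝ}
    (hW : ∀ t, Measurable[ℱ t] (W t))
    (hc : ∀ ω t, ContinuousWithinAt (fun s => W s ω) (Ici t) t) (hb : ∀ t ω, |W t ω| ≤ w t)
    (hw : ContinuousOn w (Ici 0)) :
    IsDominatedProcess ℱ (fun t => b t * w t) fun t ω => Z t ω * W t ω where
  adapted t := (hZ.adapted t).mul (hW t)
  rightCont ω t := (hZ.rightCont ω t).mul (hc ω t)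
  bound t ω := by
    rw [abs_mul]
    exact mul_le_mul (hZ.bound t ω) (hb t ω) (abs_nonneg _) ((abs_nonneg _).trans (hZ.bound t ω))
  dom := hZ.dom.mul_continuousOn hw

/-- Fubini's theorem for a time integral with a bounded random weight. -/
theorem integral_mul_swap [IsFiniteMeasure μ] (hZ : IsDominatedProcess ℱ b Z) {W : Ω → ℝ}
    (hW : Measurable W) {C : ℝ} (hC : ∀ ω, |W ω| ≤ C) {s t : ℝ≥0} (hst : s ≤ t) :
    ∫ ω, W ω * (∫ u in (s : ℝ)..t, Z u.toNNReal ω) ∂μ =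
      ∫ u in (s : ℝ)..t, ∫ ω, W ω * Z u.toNNReal ω ∂μ := by
  have hst' : (s : ℝ) ≤ t := hst
  simp_rw [← intervalIntegral.integral_const_mul]
  refine (intervalIntegral_integral_swap ?_).symm
  rw [uIoc_of_le hst']
  have hb : Integrable (fun u => C * b u) (volume.restrict (Ioc (s : ℝ) t)) :=
    (((intervalIntegrable_iff_integrableOn_Ioc_of_le hst').1
      ((hZ.dom.int s s.coe_nonneg).symm.trans (hZ.dom.int t t.coe_nonneg)))).const_mul C
  have hmeas := measurable_uncurry_min_toNNReal_of_rightCont t (fun s _ => hZ.measurable s) hZ.rightCont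
  have hmem : ∀ᵐ p : ℝ × Ω ∂(volume.restrict (Ioc (s : ℝ) t)).prod μ, p.1 ∈ Ioc (s : ℝ) t := by
    have := (Measure.quasiMeasurePreserving_fst (μ := volume.restrict (Ioc (s : ℝ) t)) (ν := μ)).ae
      (ae_restrict_mem measurableSet_Ioc)
    exact this
  refine Integrable.mono' (hb.comp_fst μ) ?_ ?_
  · refine (((hW.comp measurable_snd).mul hmeas).aestronglyMeasurable).congr ?_
    filter_upwards [hmem] with p hp
    have h : p.1.toNNReal ≤ t := Real.toNNReal_le_iff_le_coe.2 hp.2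
    simp [Function.uncurry, min_eq_left h]
  · filter_upwards [hmem] with p hp
    have h := hZ.bound p.1.toNNReal p.2
    rw [Real.coe_toNNReal _ (s.coe_nonneg.trans hp.1.le)] at h
    simp only [Function.uncurry, Real.norm_eq_abs, abs_mul]
    exact mul_le_mul (hC _) h (abs_nonneg _) ((abs_nonneg _).trans (hC p.2))

end IsDominatedProcess

end TimeIntegral

/-! ### Kolmogorov's forward equation -/

section Forward

variable {a : ℝ → ℝ} {N : ℕ} {P : ℝ≥0 → ℝ≥0 → Matrix (Config N) (Config N) ℝ}

/-- `P s t` is only controlled for `s ≤ t`; writing the final time as `max s u` makes the statement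
meaningful for all real `u`. -/
theorem IsTransitionFunction.continuous_mulVec (hP : IsTransitionFunction a N P) (s : ℝ≥0)
    (F : Config N → ℝ) (x : Config N) :
    Continuous fun u : ℝ => (P s (max s u.toNNReal) *ᵥ F) x := by
  have h1 : ContinuousOn (fun t => (P s t *ᵥ F) x) (Ici s) := by
    simp only [Matrix.mulVec, dotProduct]
    refine continuousOn_finsetSum _ fun y _ => ContinuousOn.mul ?_ continuousOn_const
    exact (continuous_apply_apply x y).comp_continuousOn (hP.continuousOn s)
  exact h1.comp_continuous (continuous_const.max continuous_real_toNNReal) fun u =>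
    mem_Ici.2 (le_max_left _ _)

/-- By Chapman-Kolmogorov, `P_{s,u} F` has right derivative `P_{s,u} L_u F` in `u`. -/
theorem IsTransitionFunction.hasDerivWithinAt (hP : IsTransitionFunction a N P) (s : ℝ≥0)
    (F : Config N → ℝ) (x : Config N) {u : ℝ} (hu : s ≤ u) :
    HasDerivWithinAt (fun u : ℝ => (P s (max s u.toNNReal) *ᵥ F) x)
      ((P s (max s u.toNNReal) *ᵥ generator a u F) x) (Ici u) u := by
  have hu0 : 0 ≤ u := s.coe_nonneg.trans hu
  have hsu : s ≤ u.toNNReal := NNReal.le_toNNReal_of_coe_le hu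
  rw [← hasDerivWithinAt_Ioi_iff_Ici, hasDerivWithinAt_iff_tendsto_slope' self_notMem_Ioi]
  have hh : Tendsto (fun v : ℝ => (v - u).toNNReal) (𝓝[>] u) (𝓝[>] 0) := by
    refine tendsto_nhdsWithin_iff.2 ⟨?_, ?_⟩
    · have : Tendsto (fun v : ℝ => (v - u).toNNReal) (𝓝 u) (𝓝 (u - u).toNNReal) :=
        (continuous_real_toNNReal.comp (continuous_id.sub continuous_const)).tendsto u
      rw [sub_self, Real.toNNReal_zero] at this
      exact this.mono_left nhdsWithin_le_nhds
    · filter_upwards [self_mem_nhdsWithin] with v hv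
      exact Real.toNNReal_pos.2 (sub_pos.2 hv)
  have hlim : Tendsto (fun h : ℝ≥0 => ∑ y, P s u.toNNReal x y *
      (((P u.toNNReal (u.toNNReal + h) *ᵥ F) y - F y) / h)) (𝓝[>] 0)
      (𝓝 (∑ y, P s u.toNNReal x y * generator a u F y)) := by
    refine tendsto_finsetSum _ fun y _ => Tendsto.const_mul _ ?_
    have := hP.hasGenerator u.toNNReal F y
    rwa [Real.coe_toNNReal _ hu0] at this
  have hval : (P s (max s u.toNNReal) *ᵥ generator a u F) x =
      ∑ y, P s u.toNNReal x y * generator a u F y := by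
    rw [max_eq_right hsu]; rfl
  rw [hval]
  refine (hlim.comp hh).congr' ?_
  filter_upwards [self_mem_nhdsWithin] with v hv
  have huv : u < v := hv
  have h1 : u.toNNReal + (v - u).toNNReal = v.toNNReal := by
    rw [← Real.toNNReal_add hu0 (sub_nonneg.2 huv.le), add_sub_cancel]
  have h2 : u.toNNReal ≤ v.toNNReal := Real.toNNReal_le_toNNReal huv.le
  rw [slope_def_field, max_eq_right hsu, max_eq_right (hsu.trans h2), hP.comp s _ _ hsu h2,
    ← Matrix.mulVec_mulVec]
  simp only [Function.comp_apply, h1, Real.coe_toNNReal _ (sub_nonneg.2 huv.le), Matrix.mulVec,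
    dotProduct, ← Finset.sum_sub_distrib, ← mul_sub, mul_div_assoc', Finset.sum_div]

/-- The forward equation in integrated form, for observables on which the time dependence of the
generator factors out. -/
theorem IsTransitionFunction.forward_equation (hP : IsTransitionFunction a N P)
    (ha : RightContLocInt a) {F H : Config N → ℝ}
    (hFH : ∀ t x, generator a t F x = a t * H x) (x : Config N) {s t : ℝ≥0} (hst : s ≤ t) :
    (P s t *ᵥ F) x - F x =
      ∫ u in (s : ℝ)..t, a u * (P s (max s u.toNNReal) *ᵥ H) x := by
  have h := (ha.mul_continuousOn (hP.continuous_mulVec s H x).continuousOn).integral_eq_sub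
    (f := fun u : ℝ => (P s (max s u.toNNReal) *ᵥ F) x) s.coe_nonneg (NNReal.coe_le_coe.2 hst)
    (hP.continuous_mulVec s F x).continuousOn fun u hu => by
      refine (hP.hasDerivWithinAt s F x hu).congr_deriv ?_
      have : generator a u F = a u • H := funext fun y => by rw [hFH, Pi.smul_apply, smul_eq_mul]
      rw [this, Matrix.mulVec_smul, Pi.smul_apply, smul_eq_mul]
  rw [h]
  simp [max_eq_right hst, hP.refl]

end Forward

/-! ### Dynkin martingales of the chain -/

section Dynkin

variable {a : ℝ → ℝ} {N : ℕ} {Ω : Type*} [m : MeasurableSpace Ω] {μ : Measure Ω}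
  {ℱ : Filtration ℝ≥0 m} {X : ℝ≥0 → Ω → Config N}

theorem IsMarkovChain.adapted_comp (hX : IsMarkovChain a N μ ℱ X) (F : Config N → ℝ) (t : ℝ≥0) :
    Measurable[ℱ t] fun ω => F (X t ω) :=
  (measurable_of_countable F).comp (hX.adapted t)

theorem IsMarkovChain.rightCont_comp (hX : IsMarkovChain a N μ ℱ X) (F : Config N → ℝ) (ω : Ω)
    (t : ℝ≥0) : ContinuousWithinAt (fun s => F (X s ω)) (Ici t) t :=
  (continuous_of_discreteTopology (f := F)).continuousAt.comp_continuousWithinAt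
    (hX.rightCont ω t)

theorem IsMarkovChain.isDominatedProcess (hX : IsMarkovChain a N μ ℱ X) (ha : RightContLocInt a)
    (ha0 : ∀ t, 0 ≤ t → 0 ≤ a t) {H : Config N → ℝ} {C : ℝ} (hC : ∀ x, |H x| ≤ C) :
    IsDominatedProcess ℱ (fun t => a t * C) fun t ω => a t * H (X t ω) where
  adapted t := (hX.adapted_comp H t).const_mul _
  rightCont ω t := by
    refine ContinuousWithinAt.mul ?_ (hX.rightCont_comp H ω t)
    exact (ha.rightCont t t.coe_nonneg).comp NNReal.continuous_coe.continuousWithinAt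
      fun u hu => NNReal.coe_le_coe.2 hu
  bound t ω := by
    rw [abs_mul, abs_of_nonneg (ha0 t t.coe_nonneg)]
    exact mul_le_mul_of_nonneg_left (hC _) (ha0 t t.coe_nonneg)
  dom := ha.mul_continuousOn continuousOn_const

theorem exists_abs_le (F : Config N → ℝ) : ∃ C, ∀ x, |F x| ≤ C := by
  obtain ⟨C, hC⟩ := (Set.finite_range fun x => |F x|).bddAbove
  exact ⟨C, fun x => hC ⟨x, rfl⟩⟩

theorem IsMarkovChain.integrable_comp [IsFiniteMeasure μ] (hX : IsMarkovChain a N μ ℱ X)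
    (F : Config N → ℝ) (t : ℝ≥0) : Integrable (fun ω => F (X t ω)) μ := by
  obtain ⟨C, hC⟩ := exists_abs_le F
  exact Integrable.of_bound ((hX.adapted_comp F t).mono (ℱ.le t) le_rfl).aestronglyMeasurable C
    (Eventually.of_forall fun ω => hC _)

theorem IsMarkovChain.setIntegral_comp [IsFiniteMeasure μ] (hX : IsMarkovChain a N μ ℱ X)
    (F : Config N → ℝ) (s : ℝ≥0) (A : Set Ω) :
    ∫ ω in A, F (X s ω) ∂μ = ∑ y, ((μ.restrict A).map (X s)).real {y} * F y := by
  have hm : Measurable (X s) := (hX.adapted s).mono (ℱ.le s) le_rfl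
  rw [← integral_map hm.aemeasurable (measurable_of_countable F).aestronglyMeasurable,
    integral_fintype .of_finite]
  rfl

/-- **Dynkin's formula**, for observables on which the time dependence of the generator factors
out. The increments are centred because the forward equation identifies `E[F(X_t) - F(X_s); A]`
with the integral of `a(u) E[H(X_u); A]` over `[s, t]` for `A ∈ ℱ_s`. -/
theorem IsMarkovChain.martingale_dynkin [IsFiniteMeasure μ] (hX : IsMarkovChain a N μ ℱ X)
    (ha : RightContLocInt a) (ha0 : ∀ t, 0 ≤ t → 0 ≤ a t) {F H : Config N → ℝ}
    (hFH : ∀ t x, generator a t F x = a t * H x) :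
    Martingale (fun t ω => F (X t ω) - F (X 0 ω) - timeIntegral (fun s ω => a s * H (X s ω)) t ω)
      ℱ μ := by
  obtain ⟨C, hC⟩ := exists_abs_le H
  have hZ := hX.isDominatedProcess ha ha0 hC
  have hadapt : ∀ t, Measurable[ℱ t] fun ω => F (X t ω) - F (X 0 ω) -
      timeIntegral (fun s ω => a s * H (X s ω)) t ω := fun t =>
    ((hX.adapted_comp F t).sub ((hX.adapted_comp F 0).mono (ℱ.mono zero_le) le_rfl)).sub
      (hZ.timeIntegral_adapted t)
  have hint : ∀ t, Integrable (fun ω => F (X t ω) - F (X 0 ω) -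
      timeIntegral (fun s ω => a s * H (X s ω)) t ω) μ := fun t =>
    ((hX.integrable_comp F t).sub (hX.integrable_comp F 0)).sub (hZ.integrable_timeIntegral t)
  refine ⟨fun t => (hadapt t).stronglyMeasurable, fun s t hst => ?_⟩
  refine (ae_eq_condExp_of_forall_setIntegral_eq (ℱ.le s) (hint t)
    (fun A _ _ => (hint s).integrableOn) (fun A hA _ => ?_)
    (hadapt s).stronglyMeasurable.aestronglyMeasurable).symm
  obtain ⟨P, hP, hmarkov⟩ := hX.markov
  have hA' : MeasurableSet A := ℱ.le s A hA
  have hcond : ∀ u, s ≤ u → ∀ G : Config N → ℝ,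
      ∫ ω in A, G (X u ω) ∂μ = ∑ y, ((μ.restrict A).map (X s)).real {y} * (P s u *ᵥ G) y := by
    intro u hu G
    rw [← setIntegral_condExp (ℱ.le s) (hX.integrable_comp G u) hA,
      setIntegral_congr_ae hA' ((hmarkov s u hu G).mono fun ω h _ => h), hX.setIntegral_comp]
  -- the left-hand side is `E[F(X_t) - F(X_s); A]`, computed with the forward equation
  have hF : ∫ ω in A, F (X t ω) ∂μ - ∫ ω in A, F (X s ω) ∂μ =
      ∫ u in (s : ℝ)..t, a u * ∫ ω in A, H (X u.toNNReal ω) ∂μ := by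
    rw [hcond t hst F, hX.setIntegral_comp, ← Finset.sum_sub_distrib]
    simp_rw [← mul_sub, hP.forward_equation ha hFH _ hst, ← intervalIntegral.integral_const_mul]
    rw [← intervalIntegral.integral_finsetSum]
    · refine intervalIntegral.integral_congr fun u hu => ?_
      rw [uIcc_of_le (NNReal.coe_le_coe.2 hst)] at hu
      have hsu : s ≤ u.toNNReal := NNReal.le_toNNReal_of_coe_le hu.1
      simp only [hcond _ hsu H, max_eq_right hsu, Finset.mul_sum]
      exact Finset.sum_congr rfl fun y _ => by ring
    · intro y _
      exact ((ha.mul_continuousOn (hP.continuous_mulVec s H y).continuousOn).intervalIntegrable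
        s.coe_nonneg t.coe_nonneg).const_mul _
  have hI : ∫ ω in A, timeIntegral (fun s ω => a s * H (X s ω)) t ω ∂μ -
      ∫ ω in A, timeIntegral (fun s ω => a s * H (X s ω)) s ω ∂μ =
      ∫ u in (s : ℝ)..t, a u * ∫ ω in A, H (X u.toNNReal ω) ∂μ := by
    rw [← integral_sub (hZ.integrable_timeIntegral t).integrableOn
      (hZ.integrable_timeIntegral s).integrableOn]
    simp_rw [hZ.timeIntegral_sub]
    have h := hZ.integral_mul_swap (μ := μ.restrict A) (W := fun _ => 1) measurable_const
      (C := 1) (by simp) hst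
    simp only [one_mul] at h
    rw [h]
    refine intervalIntegral.integral_congr fun u hu => ?_
    rw [uIcc_of_le (NNReal.coe_le_coe.2 hst)] at hu
    simp only [Real.coe_toNNReal _ (s.coe_nonneg.trans hu.1), integral_const_mul]
  have hsplit : ∀ t, ∫ ω in A, (F (X t ω) - F (X 0 ω) -
      timeIntegral (fun s ω => a s * H (X s ω)) t ω) ∂μ = ∫ ω in A, F (X t ω) ∂μ -
      ∫ ω in A, F (X 0 ω) ∂μ - ∫ ω in A, timeIntegral (fun s ω => a s * H (X s ω)) t ω ∂μ := by
    intro t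
    have h : Integrable (fun ω => F (X t ω) - F (X 0 ω)) μ :=
      (hX.integrable_comp F t).sub (hX.integrable_comp F 0)
    rw [integral_sub h.integrableOn (hZ.integrable_timeIntegral t).integrableOn,
      integral_sub (hX.integrable_comp F t).integrableOn (hX.integrable_comp F 0).integrableOn]
  rw [hsplit, hsplit]
  linarith

end Dynkin

/-! ### The second moment of a Dynkin martingale -/

section SecondMoment

variable {Ω : Type*} [m : MeasurableSpace Ω] {μ : Measure Ω} {ℱ : Filtration ℝ≥0 m}

/-- The increments of a martingale after time `s` are orthogonal to bounded `ℱ_s`-measurable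
weights. -/
theorem integral_mul_martingale [IsFiniteMeasure μ] {M : ℝ≥0 → Ω → ℝ} (hM : Martingale M ℱ μ)
    {s t : ℝ≥0} (hst : s ≤ t) {W : Ω → ℝ} (hW : Measurable[ℱ s] W) {C : ℝ} (hC : ∀ ω, |W ω| ≤ C) :
    ∫ ω, W ω * M t ω ∂μ = ∫ ω, W ω * M s ω ∂μ := by
  have hint : Integrable (W * M t) μ := (hM.integrable t).bdd_mul
    (hW.mono (ℱ.le s) le_rfl).aestronglyMeasurable (Eventually.of_forall hC)
  have h := condExp_mul_of_stronglyMeasurable_left hW.stronglyMeasurable hint (hM.integrable t)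
  have h2 : ∫ ω, (W * M t) ω ∂μ = ∫ ω, W ω * M s ω ∂μ := by
    rw [← integral_condExp (ℱ.le s)]
    refine integral_congr_ae ?_
    filter_upwards [h, hM.condExp_ae_eq hst] with ω h1 h2
    rw [h1, Pi.mul_apply, h2]
  exact h2

/-- If `Y` and `Y²` have drifts `Z` and `(2 Y + c) Z`, then the martingale part `M` of `Y` satisfies
`E[M_t²] = c E[∫_0^t Z]`, as it must since its predictable quadratic variation is `c ∫ Z`. With
`A = ∫ Z`, expanding `Y = Y_0 + A + M` and `A² = 2 ∫ Z A` turns the martingale of `Y²` into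
`M² + 2 Y_0 M + 2 A M - 2 ∫ Z M - c A`, and `E[A_t M_t] = E[∫_0^t Z M]` by the martingale property
of `M`. -/
theorem integral_sq_martingale [IsFiniteMeasure μ] {b : ℝ → ℝ} {Y Z : ℝ≥0 → Ω → ℝ} {c : ℝ}
    (hZ : IsDominatedProcess ℱ b Z) (hYm : ∀ t, Measurable[ℱ t] (Y t))
    (hYc : ∀ ω t, ContinuousWithinAt (fun s => Y s ω) (Ici t) t) (hYb : ∀ t ω, |Y t ω| ≤ 1)
    (hM : Martingale (fun t ω => Y t ω - Y 0 ω - timeIntegral Z t ω) ℱ μ)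
    (hD : Martingale (fun t ω => Y t ω ^ 2 - Y 0 ω ^ 2 -
      timeIntegral (fun s ω => Z s ω * (2 * Y s ω + c)) t ω) ℱ μ) (t : ℝ≥0) :
    ∫ ω, (Y t ω - Y 0 ω - timeIntegral Z t ω) ^ 2 ∂μ = c * ∫ ω, timeIntegral Z t ω ∂μ := by
  set M : ℝ≥0 → Ω → ℝ := fun t ω => Y t ω - Y 0 ω - timeIntegral Z t ω with hMdef
  have hMm : ∀ t, Measurable[ℱ t] (M t) := fun t => (hM.stronglyMeasurable t).measurable
  have hMc : ∀ ω t, ContinuousWithinAt (fun s => M s ω) (Ici t) t := fun ω t =>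
    ((hYc ω t).sub continuousWithinAt_const).sub (hZ.rightCont_timeIntegral ω t)
  have hMb : ∀ (t : ℝ≥0) ω, |M t ω| ≤ 2 + ∫ s in (0 : ℝ)..t, b s := fun t ω => by
    have h1 := abs_sub (Y t ω - Y 0 ω) (timeIntegral Z t ω)
    have h2 := abs_sub (Y t ω) (Y 0 ω)
    linarith [hYb t ω, hYb 0 ω, hZ.abs_timeIntegral_le t ω]
  have hZM : IsDominatedProcess ℱ _ fun t ω => Z t ω * M t ω :=
    hZ.mul hMm hMc hMb (continuousOn_const.add hZ.dom.continuousOn_primitive)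
  -- pathwise expansion of the martingale associated with `Y²`
  have hpath : ∀ ω, Y t ω ^ 2 - Y 0 ω ^ 2 -
      timeIntegral (fun s ω => Z s ω * (2 * Y s ω + c)) t ω =
      M t ω ^ 2 + 2 * (Y 0 ω * M t ω) + 2 * (M t ω * timeIntegral Z t ω) -
        2 * timeIntegral (fun t ω => Z t ω * M t ω) t ω - c * timeIntegral Z t ω := by
    intro ω
    have hsq := (hZ.path ω).sq_primitive t.coe_nonneg
    have hZA := ((hZ.path ω).mul_continuousOn (hZ.path ω).continuousOn_primitive).int t t.coe_nonneg
    have h1 : timeIntegral (fun s ω => Z s ω * (2 * Y s ω + c)) t ω =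
        (2 * Y 0 ω + c) * timeIntegral Z t ω + timeIntegral Z t ω ^ 2 +
          2 * timeIntegral (fun t ω => Z t ω * M t ω) t ω := by
      simp only [timeIntegral]
      rw [hsq, ← intervalIntegral.integral_const_mul, ← intervalIntegral.integral_const_mul,
        ← intervalIntegral.integral_add (((hZ.path ω).int t t.coe_nonneg).const_mul _)
          (hZA.const_mul 2),
        ← intervalIntegral.integral_add ((((hZ.path ω).int t t.coe_nonneg).const_mul _).add
          (hZA.const_mul 2)) (((hZM.path ω).int t t.coe_nonneg).const_mul _)]
      refine intervalIntegral.integral_congr fun s hs => ?_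
      rw [uIcc_of_le t.coe_nonneg] at hs
      simp only [hMdef, timeIntegral, Real.coe_toNNReal _ hs.1]
      ring
    rw [h1]
    simp only [hMdef]
    ring
  have hM0 : ∀ ω, M 0 ω = 0 := fun ω => by simp [hMdef, timeIntegral]
  have hY0 : ∫ ω, Y 0 ω * M t ω ∂μ = 0 := by
    rw [integral_mul_martingale hM zero_le (hYm 0) (hYb 0)]
    simp [hM0]
  have hAM : ∫ ω, M t ω * timeIntegral Z t ω ∂μ =
      ∫ ω, timeIntegral (fun t ω => Z t ω * M t ω) t ω ∂μ := by
    have h1 := hZ.integral_mul_swap (μ := μ) ((hMm t).mono (ℱ.le t) le_rfl) (hMb t)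
      (zero_le : 0 ≤ t)
    have h2 := hZM.integral_mul_swap (μ := μ) (W := fun _ => 1) measurable_const
      (C := 1) (by simp) (zero_le : 0 ≤ t)
    simp only [one_mul, NNReal.coe_zero] at h1 h2
    refine h1.trans (Eq.trans ?_ h2.symm)
    refine intervalIntegral.integral_congr fun s hs => ?_
    rw [uIcc_of_le t.coe_nonneg] at hs
    have hst : s.toNNReal ≤ t := Real.toNNReal_le_iff_le_coe.2 hs.2
    have h3 := integral_mul_martingale hM hst (hZ.adapted _) (hZ.bound _)
    simpa only [mul_comm (M t _)] using h3
  have hDint : ∫ ω, (Y t ω ^ 2 - Y 0 ω ^ 2 -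
      timeIntegral (fun s ω => Z s ω * (2 * Y s ω + c)) t ω) ∂μ = 0 := by
    have h := integral_mul_martingale hD (zero_le : 0 ≤ t) (W := fun _ => 1)
      measurable_const (C := 1) (by simp)
    simpa [timeIntegral] using h
  have hMmeas : AEStronglyMeasurable (M t) μ := ((hMm t).mono (ℱ.le t) le_rfl).aestronglyMeasurable
  have i1 : Integrable (fun ω => M t ω ^ 2) μ := by
    simpa only [pow_two] using
      (hM.integrable t).bdd_mul hMmeas (Eventually.of_forall (hMb t))
  have i2 : Integrable (fun ω => Y 0 ω * M t ω) μ := (hM.integrable t).bdd_mul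
    ((hYm 0).mono (ℱ.le 0) le_rfl).aestronglyMeasurable (Eventually.of_forall (hYb 0))
  have i3 : Integrable (fun ω => M t ω * timeIntegral Z t ω) μ :=
    (hZ.integrable_timeIntegral t).bdd_mul hMmeas (Eventually.of_forall (hMb t))
  have i4 := hZM.integrable_timeIntegral (μ := μ) t
  have i5 := hZ.integrable_timeIntegral (μ := μ) t
  simp_rw [hpath] at hDint
  have i12 : Integrable (fun ω => M t ω ^ 2 + 2 * (Y 0 ω * M t ω)) μ := i1.add (i2.const_mul 2)
  have i123 : Integrable (fun ω => M t ω ^ 2 + 2 * (Y 0 ω * M t ω) +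
      2 * (M t ω * timeIntegral Z t ω)) μ := i12.add (i3.const_mul 2)
  have i1234 : Integrable (fun ω => M t ω ^ 2 + 2 * (Y 0 ω * M t ω) +
      2 * (M t ω * timeIntegral Z t ω) - 2 * timeIntegral (fun t ω => Z t ω * M t ω) t ω) μ :=
    i123.sub (i4.const_mul 2)
  rw [integral_sub i1234 (i5.const_mul c), integral_sub i123 (i4.const_mul 2),
    integral_add i12 (i3.const_mul 2), integral_add i1 (i2.const_mul 2), integral_const_mul,
    integral_const_mul, integral_const_mul, integral_const_mul, hY0, hAM] at hDint
  change ∫ ω, M t ω ^ 2 ∂μ = _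
  linarith

end SecondMoment

/-! ### The generator on functions of the fraction of Green agents -/

section Fraction

variable {N : ℕ}

theorem greenFraction_mem_Icc (x : Config N) : greenFraction x ∈ Icc (0 : ℝ) 1 := by
  refine ⟨by unfold greenFraction; positivity, div_le_one_of_le₀ ?_ N.cast_nonneg⟩
  have := Finset.card_filter_le (Finset.univ : Finset (Fin N)) fun i => x i = Status.G
  rw [Finset.card_univ, Fintype.card_fin] at this
  exact_mod_cast this

theorem greenCount_update (x : Config N) {i : Fin N} (hi : x i = Status.D) :
    greenCount (Function.update x i Status.G) = greenCount x + 1 := by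
  have h : (Finset.univ.filter fun j => Function.update x i Status.G j = Status.G) =
      insert i (Finset.univ.filter fun j => x j = Status.G) := by
    ext j
    by_cases hj : j = i
    · subst hj; simp
    · simp [hj]
  rw [greenCount, h, Finset.card_insert_of_notMem (by simp [hi])]
  rfl

theorem card_deliberating (x : Config N) :
    ((Finset.univ.filter fun i => x i = Status.D).card : ℝ) = N - greenCount x := by
  have h := Finset.card_filter_add_card_filter_not (s := (Finset.univ : Finset (Fin N)))
    (fun i => x i = Status.G)
  have h2 : (Finset.univ.filter fun i => ¬ x i = Status.G) =
      Finset.univ.filter fun i => x i = Status.D := by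
    ext i
    cases hx : x i <;> simp [hx]
  rw [h2, Finset.card_univ, Fintype.card_fin] at h
  rw [eq_sub_iff_add_eq, add_comm]
  exact_mod_cast h

/-- Each of the `N (1 - p)` Deliberating agents turns Green at rate `a(t) p`, which moves the fraction
`p` of Green agents to `p + 1 / N`. -/
theorem generator_comp_greenFraction (hN : 1 ≤ N) (a : ℝ → ℝ) (φ : ℝ → ℝ) (t : ℝ) (x : Config N) :
    generator a t (fun x => φ (greenFraction x)) x =
      a t * ((1 - greenFraction x) * greenFraction x *
        (N * (φ (greenFraction x + 1 / N) - φ (greenFraction x)))) := by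
  have hN' : (N : ℝ) ≠ 0 := by positivity
  have h : ∀ i, (if x i = Status.D then rate a t x *
      (φ (greenFraction (Function.update x i Status.G)) - φ (greenFraction x)) else 0) =
      if x i = Status.D then rate a t x *
        (φ (greenFraction x + 1 / N) - φ (greenFraction x)) else 0 := fun i => by
    split_ifs with hi
    · have : greenFraction (Function.update x i Status.G) = greenFraction x + 1 / N := by
        rw [greenFraction, greenFraction, greenCount_update x hi, ← add_div]
        push_cast; rfl
      rw [this]
    · rfl
  rw [generator, Finset.sum_congr rfl fun i _ => h i, ← Finset.sum_filter, Finset.sum_const,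
    nsmul_eq_mul, card_deliberating]
  have h2 : (N : ℝ) - greenCount x = (1 - greenFraction x) * N := by
    rw [greenFraction]; field_simp
  rw [h2, rate, ← greenFraction]
  ring

end Fraction

/-! ### Doob's maximal inequality for right-continuous martingales -/

section Doob

variable {Ω : Type*} [m : MeasurableSpace Ω] {μ : Measure Ω} {ℱ : Filtration ℝ≥0 m}
  {M : ℝ≥0 → Ω → ℝ}

theorem submartingale_sq [IsFiniteMeasure μ] (hM : Martingale M ℱ μ)
    (h2 : ∀ t, Integrable (fun ω => M t ω ^ 2) μ) :
    Submartingale (fun t ω => M t ω ^ 2) ℱ μ := by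
  refine ⟨fun t => (hM.stronglyMeasurable t).pow 2, fun s t hst => ?_, h2⟩
  have h := (even_two.convexOn_pow (𝕜 := ℝ)).map_condExp_le_univ (ℱ.le s)
    (continuous_pow 2).lowerSemicontinuous (hM.integrable t) (h2 t)
  filter_upwards [h, hM.condExp_ae_eq hst] with ω h1 h3
  rw [Function.comp_apply, h3] at h1
  exact h1

/-- Doob's maximal inequality along an increasing sequence of times, as a limit of the discrete
inequality over its initial segments. -/
theorem measure_exists_grid_le [IsFiniteMeasure μ] (hM : Martingale M ℱ μ)
    (h2 : ∀ t, Integrable (fun ω => M t ω ^ 2) μ) {g : ℕ → ℝ≥0} (hg : Monotone g) {T : ℝ≥0}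
    (hgT : ∀ k, g k ≤ T) {c : ℝ} (hc : 0 < c) :
    μ {ω | ∃ k, c ≤ M (g k) ω ^ 2} ≤ ENNReal.ofReal ((∫ ω, M T ω ^ 2 ∂μ) / c) := by
  let 𝒢 : Filtration ℕ m :=
    { seq := fun k => ℱ (g k)
      mono' := fun i j hij => ℱ.mono (hg hij)
      le' := fun k => ℱ.le _ }
  have hsub := submartingale_sq hM h2
  have hG : Submartingale (fun k ω => M (g k) ω ^ 2) 𝒢 μ :=
    ⟨fun k => hsub.stronglyMeasurable (g k), fun i j hij => hsub.ae_le_condExp (hg hij),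
      fun k => h2 _⟩
  have hfin : ∀ n, μ {ω | ∃ k ≤ n, c ≤ M (g k) ω ^ 2} ≤
      ENNReal.ofReal ((∫ ω, M T ω ^ 2 ∂μ) / c) := fun n => by
    have h := maximal_ineq hG (fun k ω => sq_nonneg _) (ε := c.toNNReal) n
    have hset : {ω | (c.toNNReal : ℝ) ≤ (Finset.range (n + 1)).sup'
        Finset.nonempty_range_add_one fun k => M (g k) ω ^ 2} = {ω | ∃ k ≤ n, c ≤ M (g k) ω ^ 2} := by
      ext ω
      simp [Finset.le_sup'_iff, Real.coe_toNNReal _ hc.le]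
    rw [hset] at h
    rw [ENNReal.ofReal_div_of_pos hc, ENNReal.le_div_iff_mul_le (by simp [hc]) (by simp), mul_comm]
    refine h.trans (ENNReal.ofReal_le_ofReal ?_)
    refine (setIntegral_le_integral (h2 _) (Eventually.of_forall fun ω => sq_nonneg _)).trans ?_
    simpa using hsub.setIntegral_le (hgT n) MeasurableSet.univ
  have hU : {ω | ∃ k, c ≤ M (g k) ω ^ 2} = ⋃ n, {ω | ∃ k ≤ n, c ≤ M (g k) ω ^ 2} := by
    ext ω
    simp only [mem_ofPred_eq, mem_iUnion]
    exact ⟨fun ⟨k, hk⟩ => ⟨k, k, le_rfl, hk⟩, fun ⟨_, k, _, hk⟩ => ⟨k, hk⟩⟩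
  have hmono : Monotone fun n => {ω | ∃ k ≤ n, c ≤ M (g k) ω ^ 2} :=
    fun i j hij ω ⟨k, hk, h⟩ => ⟨k, hk.trans hij, h⟩
  rw [hU, hmono.measure_iUnion]
  exact iSup_le hfin

/-- **Doob's maximal inequality** for right-continuous square-integrable martingales. By
right-continuity, an exceedance of the level `c` is seen by all sufficiently fine grids. -/
theorem measure_exists_lt_sq_le [IsFiniteMeasure μ] (hM : Martingale M ℱ μ)
    (h2 : ∀ t, Integrable (fun ω => M t ω ^ 2) μ)
    (hc : ∀ ω t, ContinuousWithinAt (fun s => M s ω) (Ici t) t) (T : ℝ≥0) {c : ℝ} (hc0 : 0 < c) :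
    μ {ω | ∃ t ≤ T, c < M t ω ^ 2} ≤ ENNReal.ofReal ((∫ ω, M T ω ^ 2 ∂μ) / c) := by
  let g : ℕ → ℕ → ℝ≥0 := fun n k => min (((k : ℝ≥0) + 1) / ((n : ℝ≥0) + 1)) T
  have hg : ∀ n, Monotone (g n) := fun n i j hij => by
    have : (i : ℝ≥0) ≤ j := by exact_mod_cast hij
    simp only [g]
    gcongr
  have hsub : {ω | ∃ t ≤ T, c < M t ω ^ 2} ⊆
      ⋃ i, ⋂ n ≥ i, {ω | ∃ k, c ≤ M (g n k) ω ^ 2} := by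
    rintro ω ⟨t, ht, hlt⟩
    have h1 := tendsto_grid t T
    rw [min_eq_left ht] at h1
    have h3 := ((hc ω t).tendsto.comp h1).pow 2
    obtain ⟨i, hi⟩ := eventually_atTop.1 (h3.eventually_const_lt hlt)
    simp only [mem_iUnion, mem_iInter]
    exact ⟨i, fun n hn => ⟨⌊((n : ℝ≥0) + 1) * t⌋₊, (hi n hn).le⟩⟩
  refine (measure_mono hsub).trans ?_
  have hmono : Monotone fun i => ⋂ n ≥ i, {ω | ∃ k, c ≤ M (g n k) ω ^ 2} :=
    fun i j hij => biInter_mono (fun n hn => le_trans hij hn) fun _ _ => le_rfl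
  rw [hmono.measure_iUnion]
  exact iSup_le fun i => (measure_mono (biInter_subset_of_mem (le_refl i))).trans
    (measure_exists_grid_le hM h2 (hg i) (fun k => min_le_right _ _) hc0)

theorem measurable_iSup_sq (hm : ∀ t, Measurable (M t))
    (hc : ∀ ω t, ContinuousWithinAt (fun s => M s ω) (Ici t) t) (T : ℝ≥0) :
    Measurable fun ω => ⨆ t ∈ Iic T, ENNReal.ofReal (M t ω ^ 2) := by
  let g : ℕ → ℕ → ℝ≥0 := fun n k => min (((k : ℝ≥0) + 1) / ((n : ℝ≥0) + 1)) T
  -- right-continuity reduces the supremum to the countably many grid times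
  have h : (fun ω => ⨆ t ∈ Iic T, ENNReal.ofReal (M t ω ^ 2)) =
      fun ω => ⨆ n, ⨆ k, ENNReal.ofReal (M (g n k) ω ^ 2) := by
    ext ω
    refine le_antisymm (iSup₂_le fun t ht => ?_) (iSup₂_le fun n k => ?_)
    · have h1 := tendsto_grid t T
      rw [min_eq_left ht] at h1
      have h3 := ENNReal.tendsto_ofReal (((hc ω t).tendsto.comp h1).pow 2)
      exact le_of_tendsto' h3 fun n => le_iSup₂_of_le n ⌊((n : ℝ≥0) + 1) * t⌋₊ le_rfl
    · exact le_iSup₂_of_le (g n k) (mem_Iic.2 (min_le_right _ _)) le_rfl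
  rw [h]
  exact Measurable.iSup fun n => Measurable.iSup fun k => ((hm _).pow_const 2).ennreal_ofReal

/-- For a uniformly bounded martingale the weak-type maximal inequality already controls the second
moment of the running maximum. -/
theorem lintegral_iSup_sq_le [IsProbabilityMeasure μ] (hM : Martingale M ℱ μ)
    (h2 : ∀ t, Integrable (fun ω => M t ω ^ 2) μ)
    (hc : ∀ ω t, ContinuousWithinAt (fun s => M s ω) (Ici t) t) (T : ℝ≥0) {β : ℝ}
    (hβ : ∀ t ≤ T, ∀ ω, |M t ω| ≤ β) {c : ℝ} (hc0 : 0 < c) :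
    ∫⁻ ω, ⨆ t ∈ Iic T, ENNReal.ofReal (M t ω ^ 2) ∂μ ≤
      ENNReal.ofReal (c + β ^ 2 * ((∫ ω, M T ω ^ 2 ∂μ) / c)) := by
  have hmeas := measurable_iSup_sq
    (fun t => (hM.stronglyMeasurable t).measurable.mono (ℱ.le t) le_rfl) hc T
  set S : Ω → ℝ≥0∞ := fun ω => ⨆ t ∈ Iic T, ENNReal.ofReal (M t ω ^ 2) with hS
  set E : Set Ω := {ω | ENNReal.ofReal c < S ω} with hE
  have hEm : MeasurableSet E := measurableSet_lt measurable_const hmeas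
  have hEle : μ E ≤ ENNReal.ofReal ((∫ ω, M T ω ^ 2 ∂μ) / c) := by
    refine (measure_mono fun ω hω => ?_).trans (measure_exists_lt_sq_le hM h2 hc T hc0)
    simp only [hE, hS, mem_ofPred_eq, lt_iSup_iff] at hω
    obtain ⟨t, ht, h⟩ := hω
    exact ⟨t, ht, ((ENNReal.ofReal_lt_ofReal_iff_of_nonneg hc0.le).1 h)⟩
  have hSβ : ∀ ω, S ω ≤ ENNReal.ofReal (β ^ 2) := fun ω => iSup₂_le fun t ht =>
    ENNReal.ofReal_le_ofReal (sq_le_sq' (abs_le.1 (hβ t ht ω)).1 (abs_le.1 (hβ t ht ω)).2)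
  calc ∫⁻ ω, S ω ∂μ
      ≤ ∫⁻ ω, ENNReal.ofReal c + E.indicator (fun _ => ENNReal.ofReal (β ^ 2)) ω ∂μ := by
        refine lintegral_mono fun ω => ?_
        by_cases hω : ω ∈ E
        · rw [indicator_of_mem hω]
          exact (hSβ ω).trans le_add_self
        · exact (not_lt.1 hω).trans le_self_add
    _ = ENNReal.ofReal c + ENNReal.ofReal (β ^ 2) * μ E := by
        rw [lintegral_add_left measurable_const, lintegral_indicator_const hEm]
        simp
    _ ≤ ENNReal.ofReal c + ENNReal.ofReal (β ^ 2) * ENNReal.ofReal ((∫ ω, M T ω ^ 2 ∂μ) / c) := by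
        gcongr
    _ = _ := by
        have h0 : 0 ≤ (∫ ω, M T ω ^ 2 ∂μ) / c :=
          div_nonneg (integral_nonneg fun ω => sq_nonneg _) hc0.le
        rw [← ENNReal.ofReal_mul (sq_nonneg β), ← ENNReal.ofReal_add hc0.le (by positivity)]

end Doob

/-! ### Fluctuations of the fraction of Green agents -/

/-- The logistic drift `a(t) (1 - p) p` of the fraction `p` of Green agents. -/
noncomputable def drift {N : ℕ} {Ω : Type*} (a : ℝ → ℝ)
    (X : ℝ≥0 → Ω → Config N) (t : ℝ≥0) (ω : Ω) : ℝ :=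
  a t * ((1 - greenFraction (X t ω)) * greenFraction (X t ω))

/-- The fraction of Green agents, minus its initial value, compensated by its accumulated drift. -/
noncomputable def fluctuation {N : ℕ} {Ω : Type*} (a : ℝ → ℝ)
    (X : ℝ≥0 → Ω → Config N) (t : ℝ≥0) (ω : Ω) : ℝ :=
  greenFraction (X t ω) - greenFraction (X 0 ω) - timeIntegral (drift a X) t ω

theorem greenFraction_eq_add_fluctuation {N : ℕ} {Ω : Type*} (a : ℝ → ℝ)
    (X : ℝ≥0 → Ω → Config N) (t : ℝ≥0) (ω : Ω) :
    greenFraction (X t ω) = greenFraction (X 0 ω) +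
      (∫ s in (0 : ℝ)..t, a s * (1 - greenFraction (X s.toNNReal ω)) *
        greenFraction (X s.toNNReal ω)) + fluctuation a X t ω := by
  have h : timeIntegral (drift a X) t ω = ∫ s in (0 : ℝ)..t, a s *
      (1 - greenFraction (X s.toNNReal ω)) * greenFraction (X s.toNNReal ω) := by
    refine intervalIntegral.integral_congr fun s hs => ?_
    rw [uIcc_of_le t.coe_nonneg] at hs
    simp only [drift, Real.coe_toNNReal _ hs.1, mul_assoc]
  rw [fluctuation, h]
  ring

section Fluctuation

variable {a : ℝ → ℝ} {N : ℕ} {Ω : Type*} [m : MeasurableSpace Ω] {μ : Measure Ω}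
  {ℱ : Filtration ℝ≥0 m} {X : ℝ≥0 → Ω → Config N}

theorem abs_one_sub_mul_greenFraction_le (x : Config N) :
    |(1 - greenFraction x) * greenFraction x| ≤ 1 := by
  have h := greenFraction_mem_Icc x
  rw [abs_of_nonneg (mul_nonneg (sub_nonneg.2 h.2) h.1)]
  exact mul_le_one₀ (by linarith [h.1]) h.1 h.2

theorem IsMarkovChain.isDominatedProcess_drift (hX : IsMarkovChain a N μ ℱ X)
    (ha : RightContLocInt a) (ha0 : ∀ t, 0 ≤ t → 0 ≤ a t) :
    IsDominatedProcess ℱ (fun t => a t * 1) (drift a X) :=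
  hX.isDominatedProcess ha ha0 (H := fun x => (1 - greenFraction x) * greenFraction x)
    abs_one_sub_mul_greenFraction_le

theorem IsMarkovChain.intervalIntegrable_drift (hX : IsMarkovChain a N μ ℱ X)
    (ha : RightContLocInt a) (ha0 : ∀ t, 0 ≤ t → 0 ≤ a t) (t : ℝ≥0) (ω : Ω) :
    IntervalIntegrable (fun s : ℝ => a s * (1 - greenFraction (X s.toNNReal ω)) *
      greenFraction (X s.toNNReal ω)) volume 0 t := by
  refine (((hX.isDominatedProcess_drift ha ha0).path ω).int t t.coe_nonneg).congr fun s hs => ?_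
  rw [uIoc_of_le t.coe_nonneg] at hs
  simp only [drift, Real.coe_toNNReal _ hs.1.le, mul_assoc]

theorem IsMarkovChain.rightCont_fluctuation (hX : IsMarkovChain a N μ ℱ X)
    (ha : RightContLocInt a) (ha0 : ∀ t, 0 ≤ t → 0 ≤ a t) (ω : Ω) (t : ℝ≥0) :
    ContinuousWithinAt (fun s => fluctuation a X s ω) (Ici t) t :=
  ((hX.rightCont_comp greenFraction ω t).sub continuousWithinAt_const).sub
    ((hX.isDominatedProcess_drift ha ha0).rightCont_timeIntegral ω t)

theorem integral_mono_right (ha : RightContLocInt a) (ha0 : ∀ t, 0 ≤ t → 0 ≤ a t) {s t : ℝ}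
    (hs : 0 ≤ s) (hst : s ≤ t) : ∫ u in (0 : ℝ)..s, a u ≤ ∫ u in (0 : ℝ)..t, a u :=
  intervalIntegral.integral_mono_interval le_rfl hs hst
    ((ae_restrict_mem measurableSet_Ioc).mono fun u hu => ha0 u hu.1.le) (ha.int t (hs.trans hst))

theorem IsMarkovChain.abs_fluctuation_le (hX : IsMarkovChain a N μ ℱ X)
    (ha : RightContLocInt a) (ha0 : ∀ t, 0 ≤ t → 0 ≤ a t) {t T : ℝ≥0} (htT : t ≤ T) (ω : Ω) :
    |fluctuation a X t ω| ≤ 1 + ∫ s in (0 : ℝ)..T, a s := by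
  have h1 := (hX.isDominatedProcess_drift ha ha0).abs_timeIntegral_le t ω
  simp only [mul_one] at h1
  have h2 := integral_mono_right ha ha0 t.coe_nonneg (NNReal.coe_le_coe.2 htT)
  have h3 : |greenFraction (X t ω) - greenFraction (X 0 ω)| ≤ 1 := by
    have := greenFraction_mem_Icc (X t ω)
    have := greenFraction_mem_Icc (X 0 ω)
    simp only [mem_Icc] at *
    exact abs_sub_le_iff.2 ⟨by linarith, by linarith⟩
  exact (abs_sub _ _).trans (by linarith)

/-- If the initial error and all fluctuations up to time `T` are smaller than
`ε / (3 e^{∫_0^T a})`, then the fraction of Green agents stays within `ε` of the logistic curve. -/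
theorem IsMarkovChain.setOf_deviation_subset (hX : IsMarkovChain a N μ ℱ X)
    (ha : RightContLocInt a) (ha0 : ∀ t, 0 ≤ t → 0 ≤ a t) {p₀ : ℝ} (hp : p₀ ∈ Icc (0 : ℝ) 1)
    (T : ℝ≥0) {ε : ℝ} (hε : 0 < ε) :
    {ω | ∃ t : ℝ≥0, t ≤ T ∧ ε ≤ |greenFraction (X t ω) - logistic a p₀ t|} ⊆
      {ω | ε / (3 * Real.exp (∫ s in (0 : ℝ)..T, a s)) ≤ |greenFraction (X 0 ω) - p₀|} ∪
      {ω | ENNReal.ofReal ((ε / (3 * Real.exp (∫ s in (0 : ℝ)..T, a s))) ^ 2) ≤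
        ⨆ t ∈ Iic T, ENNReal.ofReal (fluctuation a X t ω ^ 2)} := by
  set η := ε / (3 * Real.exp (∫ s in (0 : ℝ)..T, a s)) with hη
  have hη0 : 0 < η := by positivity
  rintro ω ⟨t, htT, hdev⟩
  by_contra hcon
  simp only [mem_union, mem_ofPred_eq, not_or, not_le] at hcon
  obtain ⟨h0, hsup⟩ := hcon
  have hfl : ∀ s ≤ T, |fluctuation a X s ω| < η := fun s hs => by
    have h1 := (le_iSup₂ (f := fun t (_ : t ∈ Iic T) =>
      ENNReal.ofReal (fluctuation a X t ω ^ 2)) s hs).trans_lt hsup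
    exact abs_lt_of_sq_lt_sq ((ENNReal.ofReal_lt_ofReal_iff_of_nonneg (sq_nonneg _)).1 h1) hη0.le
  have hlog := isLogisticSolution_logistic ha hp
  have hbd : ∀ r : ℝ → ℝ, (∀ t, r t ∈ Icc (0 : ℝ) 1) →
      ∀ T, 0 ≤ T → ∃ C, ∀ t ∈ Ioc 0 T, |r t| ≤ C := fun r hr _ _ =>
    ⟨1, fun t _ => by rw [abs_of_nonneg (hr t).1]; exact (hr t).2⟩
  have h := abs_sub_le_of_logistic ha ha0
    (p := fun s => greenFraction (X s.toNNReal ω)) (q := logistic a p₀)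
    (e := fun s => greenFraction (X 0 ω) + fluctuation a X s.toNNReal ω) (e' := fun _ => p₀)
    (δ := 2 * η) (K := 1) (T := T)
    (fun s _ => continuousWithinAt_comp_toNNReal (y := fun s => greenFraction (X s ω))
      (hX.rightCont_comp greenFraction ω s.toNNReal))
    (fun s hs => (hlog.continuousOn s hs).mono (Ici_subset_Ici.2 hs))
    (hbd _ fun s => greenFraction_mem_Icc _) (hbd _ fun s => logistic_mem_Icc hp s) zero_le_one
    (fun s hs => by
      have h := greenFraction_eq_add_fluctuation a X s.toNNReal ω
      rw [Real.coe_toNNReal _ hs.1] at h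
      linarith)
    (fun s hs => hlog.integral_eq s hs.1)
    (fun s hs => by
      have h1 := hfl s.toNNReal (Real.toNNReal_le_iff_le_coe.2 hs.2)
      have h2 := abs_add_le (greenFraction (X 0 ω) - p₀) (fluctuation a X s.toNNReal ω)
      rw [add_sub_right_comm]
      linarith)
    (fun s _ => by
      have h1 := greenFraction_mem_Icc (X s.toNNReal ω)
      have h2 := logistic_mem_Icc (a := a) hp s
      simp only [mem_Icc] at h1 h2
      exact abs_le.2 ⟨by linarith, by linarith⟩)
    (t := t) ⟨t.coe_nonneg, NNReal.coe_le_coe.2 htT⟩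
  simp only [Real.toNNReal_coe, mul_one] at h
  have hexp := Real.exp_le_exp.2
    (integral_mono_right ha ha0 t.coe_nonneg (NNReal.coe_le_coe.2 htT))
  have h3 : 3 * η * Real.exp (∫ s in (0 : ℝ)..T, a s) = ε := by
    rw [hη]; field_simp
  have h4 : 2 * η * Real.exp (∫ s in (0 : ℝ)..t, a s) ≤
      2 * η * Real.exp (∫ s in (0 : ℝ)..T, a s) := by gcongr
  have h5 : 0 < η * Real.exp (∫ s in (0 : ℝ)..T, a s) := by positivity
  linarith

variable [IsProbabilityMeasure μ]

theorem IsMarkovChain.martingale_fluctuation (hX : IsMarkovChain a N μ ℱ X) (hN : 1 ≤ N)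
    (ha : RightContLocInt a) (ha0 : ∀ t, 0 ≤ t → 0 ≤ a t) :
    Martingale (fluctuation a X) ℱ μ := by
  have hN' : (N : ℝ) ≠ 0 := by positivity
  refine hX.martingale_dynkin ha ha0 (F := greenFraction)
    (H := fun x => (1 - greenFraction x) * greenFraction x) fun t x => ?_
  rw [generator_comp_greenFraction hN a (fun y => y)]
  field_simp
  ring

theorem IsMarkovChain.memLp_fluctuation (hX : IsMarkovChain a N μ ℱ X) (hN : 1 ≤ N)
    (ha : RightContLocInt a) (ha0 : ∀ t, 0 ≤ t → 0 ≤ a t) (t : ℝ≥0) :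
    MemLp (fluctuation a X t) 2 μ :=
  MemLp.of_bound ((hX.martingale_fluctuation hN ha ha0).integrable t).aestronglyMeasurable _
    (Eventually.of_forall (hX.abs_fluctuation_le ha ha0 le_rfl))

theorem IsMarkovChain.integral_fluctuation (hX : IsMarkovChain a N μ ℱ X) (hN : 1 ≤ N)
    (ha : RightContLocInt a) (ha0 : ∀ t, 0 ≤ t → 0 ≤ a t) (t : ℝ≥0) :
    ∫ ω, fluctuation a X t ω ∂μ = 0 := by
  have h := integral_mul_martingale (hX.martingale_fluctuation hN ha ha0) (zero_le : 0 ≤ t)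
    (W := fun _ => 1) measurable_const (C := 1) (by simp)
  simpa [fluctuation, timeIntegral] using h

/-- Jumps of size `1 / N` occur at a total rate of order `N`, so the second moment of the
fluctuation is of order `1 / N`. -/
theorem IsMarkovChain.integral_sq_fluctuation_le (hX : IsMarkovChain a N μ ℱ X) (hN : 1 ≤ N)
    (ha : RightContLocInt a) (ha0 : ∀ t, 0 ≤ t → 0 ≤ a t) (t : ℝ≥0) :
    ∫ ω, fluctuation a X t ω ^ 2 ∂μ ≤ (∫ s in (0 : ℝ)..t, a s) / N := by
  have hN' : (N : ℝ) ≠ 0 := by positivity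
  have hZ := hX.isDominatedProcess_drift ha ha0
  have hD := hX.martingale_dynkin ha ha0 (F := fun x => greenFraction x ^ 2)
    (H := fun x => (1 - greenFraction x) * greenFraction x * (2 * greenFraction x + 1 / N))
    fun t x => by
      rw [generator_comp_greenFraction hN a (fun y => y ^ 2)]
      field_simp
      ring
  simp only [← mul_assoc (a _)] at hD
  have h := integral_sq_martingale (Y := fun t ω => greenFraction (X t ω)) (c := 1 / N) hZ
    (hX.adapted_comp greenFraction) (hX.rightCont_comp greenFraction)
    (fun t ω => by
      have h := greenFraction_mem_Icc (X t ω)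
      rw [abs_of_nonneg h.1]
      exact h.2)
    (hX.martingale_fluctuation hN ha ha0) (by simpa only [drift, ← mul_assoc (a _)] using hD) t
  refine (le_of_eq h).trans ?_
  rw [one_div, mul_comm, ← div_eq_mul_inv]
  gcongr
  have h2 : ∫ ω, timeIntegral (drift a X) t ω ∂μ ≤ ∫ _, (∫ s in (0 : ℝ)..t, a s) ∂μ := by
    refine integral_mono (hZ.integrable_timeIntegral t) (integrable_const _) fun ω => ?_
    have := hZ.abs_timeIntegral_le t ω
    simp only [mul_one] at this
    exact (le_abs_self _).trans this
  simpa using h2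

theorem IsMarkovChain.lintegral_iSup_fluctuation_le (hX : IsMarkovChain a N μ ℱ X) (hN : 1 ≤ N)
    (ha : RightContLocInt a) (ha0 : ∀ t, 0 ≤ t → 0 ≤ a t) (T : ℝ≥0) :
    ∫⁻ ω, ⨆ t ∈ Iic T, ENNReal.ofReal (fluctuation a X t ω ^ 2) ∂μ ≤
      ENNReal.ofReal ((1 + (1 + ∫ s in (0 : ℝ)..T, a s) ^ 2 * ∫ s in (0 : ℝ)..T, a s) / √N) := by
  have hN0 : (0 : ℝ) < N := by positivity
  have hsq : 0 < √(N : ℝ) := Real.sqrt_pos.2 hN0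
  -- the truncation level `1 / √N` balances the two terms of the maximal inequality
  refine (lintegral_iSup_sq_le (hX.martingale_fluctuation hN ha ha0)
    (fun t => (hX.memLp_fluctuation hN ha ha0 t).integrable_sq)
    (hX.rightCont_fluctuation ha ha0) T
    (fun t ht => hX.abs_fluctuation_le ha ha0 ht) (c := 1 / √N) (by positivity)).trans ?_
  refine ENNReal.ofReal_le_ofReal ?_
  have h := hX.integral_sq_fluctuation_le hN ha ha0 T
  calc 1 / √(N : ℝ) + (1 + ∫ s in (0 : ℝ)..T, a s) ^ 2 *
        ((∫ ω, fluctuation a X T ω ^ 2 ∂μ) / (1 / √N))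
      ≤ 1 / √(N : ℝ) + (1 + ∫ s in (0 : ℝ)..T, a s) ^ 2 *
        (((∫ s in (0 : ℝ)..T, a s) / N) / (1 / √N)) := by gcongr
    _ = _ := by
      have h1 : (N : ℝ) = √N * √N := (Real.mul_self_sqrt hN0.le).symm
      rw [h1, Real.sqrt_mul_self hsq.le]
      field_simp

end Fluctuation

end GreenTransition

/-! ### Convergence to the logistic equation -/

open GreenTransition

theorem mainTheorem1
    -- the modulation factor `a`, relevant on `[0, ∞)` only
    (a : ℝ → ℝ)
    (ha_nonneg : ∀ t, 0 ≤ t → 0 ≤ a t)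
    (ha_rightCont : ∀ t, 0 ≤ t → ContinuousWithinAt a (Ici t) t)
    (ha_int : ∀ T, 0 ≤ T → IntervalIntegrable a volume 0 T)
    -- for each `N ≥ 1`, the chain with `N` agents, on its own filtered probability space
    (Ω : ℕ → Type*) [m : ∀ N, MeasurableSpace (Ω N)]
    (μ : ∀ N, Measure (Ω N)) [∀ N, IsProbabilityMeasure (μ N)]
    (ℱ : ∀ N, Filtration ℝ≥0 (m N))
    (X : ∀ N, ℝ≥0 → Ω N → GreenTransition.Config N)
    (hX : ∀ N, 1 ≤ N → GreenTransition.IsMarkovChain a N (μ N) (ℱ N) (X N)) :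
    -- Dynkin identity, with a martingale remainder that vanishes in mean square
    (∃ M : ∀ N, ℝ≥0 → Ω N → ℝ,
      (∀ N, 1 ≤ N →
        Martingale (M N) (ℱ N) (μ N) ∧
        (∀ t, MemLp (M N t) 2 (μ N) ∧ ∫ ω, M N t ω ∂(μ N) = 0) ∧
        ∀ (t : ℝ≥0) (ω : Ω N),
          IntervalIntegrable (fun s : ℝ => a s *
            (1 - GreenTransition.greenFraction (X N s.toNNReal ω)) *
              GreenTransition.greenFraction (X N s.toNNReal ω)) volume 0 t ∧
          GreenTransition.greenFraction (X N t ω) =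
            GreenTransition.greenFraction (X N 0 ω)
              + (∫ s in (0 : ℝ)..t, a s *
                  (1 - GreenTransition.greenFraction (X N s.toNNReal ω)) *
                    GreenTransition.greenFraction (X N s.toNNReal ω))
              + M N t ω / (N : ℝ)) ∧
      (∀ t : ℝ≥0,
        Tendsto (fun N => ∫ ω, (M N t ω / (N : ℝ)) ^ 2 ∂(μ N)) atTop (𝓝 0)) ∧
      (∀ T : ℝ≥0,
        (∀ N, 1 ≤ N → Measurable fun ω =>
          ⨆ t ∈ Iic T, ENNReal.ofReal ((M N t ω / (N : ℝ)) ^ 2)) ∧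
        Tendsto (fun N => ∫⁻ ω, ⨆ t ∈ Iic T, ENNReal.ofReal ((M N t ω / (N : ℝ)) ^ 2) ∂(μ N))
          atTop (𝓝 0))) ∧
    -- convergence to the solution of the logistic equation
    (∀ p₀ ∈ Icc (0 : ℝ) 1,
      (∀ ε : ℝ, 0 < ε → Tendsto
        (fun N => μ N {ω | ε ≤ |GreenTransition.greenFraction (X N 0 ω) - p₀|}) atTop (𝓝 0)) →
      ∃ p : ℝ → ℝ,
        GreenTransition.IsLogisticSolution a p₀ p ∧
        (∀ q : ℝ → ℝ, GreenTransition.IsLogisticSolution a p₀ q → EqOn q p (Ici 0)) ∧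
        p 0 = p₀ ∧
        (∀ t, 0 ≤ t → HasDerivWithinAt p (a t * (1 - p t) * p t) (Ici t) t) ∧
        (∀ t, 0 < t → ContinuousAt a t → HasDerivAt p (a t * (1 - p t) * p t) t) ∧
        ∀ T : ℝ≥0, ∀ ε : ℝ, 0 < ε → Tendsto
          (fun N => μ N {ω | ∃ t : ℝ≥0, t ≤ T ∧
            ε ≤ |GreenTransition.greenFraction (X N t ω) - p t|}) atTop (𝓝 0)) := by

  have ha : RightContLocInt a := ⟨ha_rightCont, ha_int⟩
  have hdiv : ∀ N, 1 ≤ N → ∀ t ω, N * fluctuation a (X N) t ω / N = fluctuation a (X N) t ω :=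
    fun N hN t ω => mul_div_cancel_left₀ _ (by positivity)
  have hsqrt : ∀ C : ℝ, Tendsto (fun N : ℕ => ENNReal.ofReal (C / √N)) atTop (𝓝 0) := fun C => by
    have h : Tendsto (fun N : ℕ => C / √(N : ℝ)) atTop (𝓝 0) :=
      tendsto_const_nhds.div_atTop (Real.tendsto_sqrt_atTop.comp tendsto_natCast_atTop_atTop)
    simpa using ENNReal.tendsto_ofReal h
  have hsup : ∀ T : ℝ≥0, Tendsto (fun N => ∫⁻ ω, ⨆ t ∈ Iic T,
      ENNReal.ofReal (fluctuation a (X N) t ω ^ 2) ∂(μ N)) atTop (𝓝 0) := fun T =>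
    tendsto_of_tendsto_of_tendsto_of_le_of_le' tendsto_const_nhds (hsqrt _)
      (Eventually.of_forall fun _ => zero_le) ((eventually_ge_atTop 1).mono fun N hN =>
        (hX N hN).lintegral_iSup_fluctuation_le hN ha ha_nonneg T)
  have hmeas : ∀ N, 1 ≤ N → ∀ T : ℝ≥0, Measurable fun ω =>
      ⨆ t ∈ Iic T, ENNReal.ofReal (fluctuation a (X N) t ω ^ 2) := fun N hN T =>
    measurable_iSup_sq (fun t => (((hX N hN).martingale_fluctuation hN ha
      ha_nonneg).stronglyMeasurable t).measurable.mono ((ℱ N).le t) le_rfl)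
      ((hX N hN).rightCont_fluctuation ha ha_nonneg) T
  refine ⟨⟨fun N t ω => N * fluctuation a (X N) t ω, fun N hN => ⟨?_, fun t => ⟨?_, ?_⟩,
    fun t ω => ⟨(hX N hN).intervalIntegrable_drift ha ha_nonneg t ω, ?_⟩⟩, fun t => ?_,
    fun T => ⟨fun N hN => ?_, ?_⟩⟩, fun p₀ hp hinit => ?_⟩
  · exact ((hX N hN).martingale_fluctuation hN ha ha_nonneg).smul (N : ℝ)
  · exact ((hX N hN).memLp_fluctuation hN ha ha_nonneg t).const_mul (N : ℝ)
  · rw [integral_const_mul, (hX N hN).integral_fluctuation hN ha ha_nonneg, mul_zero]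
  · rw [hdiv N hN]
    exact greenFraction_eq_add_fluctuation a (X N) t ω
  · refine squeeze_zero' (Eventually.of_forall fun N => integral_nonneg fun ω => sq_nonneg _)
      ((eventually_ge_atTop 1).mono fun N hN => ?_)
      (tendsto_const_div_atTop_nhds_zero_nat (∫ s in (0 : ℝ)..t, a s))
    simp only [hdiv N hN]
    exact (hX N hN).integral_sq_fluctuation_le hN ha ha_nonneg t
  · simp only [hdiv N hN]
    exact hmeas N hN T
  · refine (hsup T).congr' ((eventually_ge_atTop 1).mono fun N hN => ?_)
    simp only [hdiv N hN]
  · have hsol := isLogisticSolution_logistic ha hp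
    refine ⟨logistic a p₀, hsol, fun q hq => hq.eqOn ha ha_nonneg hsol, logistic_zero,
      fun t ht => hasDerivWithinAt_logistic hp (ha.hasDerivWithinAt_primitive ht),
      fun t ht hcont => ?_, fun T ε hε => ?_⟩
    · rw [← hasDerivWithinAt_univ]
      refine hasDerivWithinAt_logistic hp (HasDerivAt.hasDerivWithinAt ?_)
      refine intervalIntegral.integral_hasDerivAt_right (ha.int t ht.le) ?_ hcont
      refine ⟨Ioc 0 (t + 1), Ioc_mem_nhds ht (by linarith), ?_⟩
      exact ((intervalIntegrable_iff_integrableOn_Ioc_of_le (by linarith)).1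
        (ha.int (t + 1) (by linarith))).aestronglyMeasurable
    · set η := ε / (3 * Real.exp (∫ s in (0 : ℝ)..T, a s)) with hη
      have hη0 : 0 < η := by positivity
      have hη2 : ENNReal.ofReal (η ^ 2) ≠ 0 := by simp [hη0.ne']
      have hlim : Tendsto (fun N => μ N {ω | η ≤ |greenFraction (X N 0 ω) - p₀|} +
          (∫⁻ ω, ⨆ t ∈ Iic T, ENNReal.ofReal (fluctuation a (X N) t ω ^ 2) ∂(μ N)) /
            ENNReal.ofReal (η ^ 2)) atTop (𝓝 0) := by
        have h := (hinit η hη0).add (ENNReal.Tendsto.div_const (hsup T) (Or.inr hη2))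
        simpa using h
      refine tendsto_of_tendsto_of_tendsto_of_le_of_le' tendsto_const_nhds hlim
        (Eventually.of_forall fun _ => zero_le) ((eventually_ge_atTop 1).mono fun N hN => ?_)
      refine (measure_mono ((hX N hN).setOf_deviation_subset ha ha_nonneg hp T hε)).trans ?_
      exact (measure_union_le _ _).trans (add_le_add le_rfl
        (meas_ge_le_lintegral_div (hmeas N hN T).aemeasurable hη2 ENNReal.ofReal_ne_top))
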